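/- Let $\|\cdot\|$ be an arbitrary norm on $\mathbb{R}^n$, with dual norm $\|c\|_*=\max_{\|y\|\le 1}|c'y|$. Let $Q$ be a symmetric positive semidefinite $n\times n$ matrix and let $A$ be an $m\times n$ matrix with rows $a_1',\dots,a_m'$. For $D\subset\{1,\dots,m\}$ let $A_D$ be the submatrix of $A$ with rows $a_i'$, $i\in D$, and $b_D=(b_i)_{i\in D}$; put $$\mathcal S_D(c,b_D)=\arg\min\{\tfrac12x'Qx+c'x : A_Dx\le b_D\}\subset\mathbb{R}^n,\qquad M_D=\begin{pmatrix}Q&A_D'\\A_D&0\end{pmatrix},$$ and $\mathcal S=\mathcal S_{\{1,\dots,m\}}$ (for $D=\emptyset$ there are no constraints and $M_\emptyset=Q$). The parameter space $\mathbb{R}^n\times\mathbb{R}^D$ carries the norm $\|(c,\beta)\|=\max\{\|c\|_*,\|\beta\|_\infty\}$. A set-valued mapping $\mathcal G$ from the parameter space to $\mathbb{R}^n$ has the Aubin property at a point $(\bar w,\bar x)$ of its graph if there are $\kappa\ge0$ and neighborhoods $V$ of $\bar w$ and $U$ of $\bar x$ such that $d(x^2,\mathcal G(w^1))\le\kappa\|w^2-w^1\|$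 for all $w^1,w^2\in V$ and $x^2\in\mathcal G(w^2)\cap U$, where $d(x,\emptyset)=+\infty$; the infimum of all such $\kappa$ is the Lipschitz modulus $\operatorname{lip}\mathcal G(\bar w,\bar x)$. Let $(\bar c,\bar b)\in\mathbb{R}^n\times\mathbb{R}^m$ be such that $\mathcal S(\bar c,\bar b)=\{\bar x\}$ and such that the Slater condition holds at $\bar b$, i.e. $a_i'y<\bar b_i$ for all $i=1,\dots,m$ and some $y\in\mathbb{R}^n$. Let $I=\{i: a_i'\bar x=\bar b_i\}$. Let $\mathcal M$ be the family of all $D\subset I$ that are minimal with respect to inclusion among the sets satisfying $-(Q\bar x+\bar c)\in\operatorname{cone}\{a_i:i\in D\}$ (with $\operatorname{cone}\emptyset=\{0\}$), and let $\mathcal L$ be the family of all $D\subset I$ such that the vectors $a_i$, $i\in D$, are linearly independent and $-(Q\bar x+\bar c)\in\operatorname{cone}\{a_i:i\in D\}$. Let $D_0\in\mathcal L$. Then the following conditions are equivalent: (i) $\mathcal S_{D_0}$ has the Aubin property at $((\bar c,\bar b_{D_0}),\bar x)$; (ii) $\mathcal S_D$ has the Aubin property at $((\bar c,\bar b_D),\bar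 x)$ for all $D\in\mathcal M$ with $D\subset D_0$; (iii) $\mathcal S_D$ has the Aubin property at $((\bar c,\bar b_D),\bar x)$ for all $D\in\mathcal L$ with $D\subset D_0$; (iv) $M_D$ is nonsingular for all $D\in\mathcal L$ with $D\subset D_0$. Moreover, under these equivalent conditions, $$\operatorname{lip}\mathcal S_{D_0}((\bar c,\bar b_{D_0}),\bar x)=\max_{D\in\mathcal L,\ D\subset D_0}\left\|\begin{pmatrix}I_n&0\end{pmatrix}M_D^{-1}\right\|,$$ where the matrix norm is the operator norm from $(\mathbb{R}^n\times\mathbb{R}^D,\ \max\{\|\cdot\|_*,\|\cdot\|_\infty\})$ to $(\mathbb{R}^n,\|\cdot\|)$. -/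

import Mathlib

open scoped Topology NNReal ENNReal Matrix

noncomputable section

namespace QuadArgmin

variable {n : ℕ} {ι : Type*}

/-! ### Convex quadratic programs and their optimal set mapping -/

/-- The feasible set `{x | a_i' x ≤ b_i for all i}`, where `a_i'` is the `i`-th row of `A`. -/
def feasible (A : Matrix ι (Fin n) ℝ) (b : ι → ℝ) : Set (Fin n → ℝ) :=
  {x | ∀ i, A i ⬝ᵥ x ≤ b i}

/-- The objective function `x ↦ ½ x'Qx + c'x`. -/
def objective (Q : Matrix (Fin n) (Fin n) ℝ) (c x : Fin n → ℝ) : ℝ :=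
  (1 / 2 : ℝ) * (x ⬝ᵥ (Q *ᵥ x)) + c ⬝ᵥ x

/-- The argmin mapping: `(c, b)` is sent to the set of all minimizers of `½ x'Qx + c'x` subject to
`A x ≤ b`. -/
def argminMap (Q : Matrix (Fin n) (Fin n) ℝ) (A : Matrix ι (Fin n) ℝ)
    (w : (Fin n → ℝ) × (ι → ℝ)) : Set (Fin n → ℝ) :=
  {x | x ∈ feasible A w.2 ∧ ∀ y ∈ feasible A w.2, objective Q w.1 x ≤ objective Q w.1 y}

/-- The Slater constraint qualification at `b`. -/
def Slater (A : Matrix ι (Fin n) ℝ) (b : ι → ℝ) : Prop :=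
  ∃ y : Fin n → ℝ, ∀ i, A i ⬝ᵥ y < b i

/-- The submatrix `A_D` formed by the rows of `A` with index in `D`. -/
def rows (A : Matrix ι (Fin n) ℝ) (D : Finset ι) : Matrix D (Fin n) ℝ :=
  fun i => A i

/-- The subvector `b_D` formed by the coordinates of `b` with index in `D`. -/
def coords (b : ι → ℝ) (D : Finset ι) : D → ℝ :=
  fun i => b i

/-! ### Norms -/

/-- The dual norm `max {|x'y| : p y ≤ 1}` of a norm `p` on `ℝⁿ`. -/
def dualNorm (p : Seminorm ℝ (Fin n → ℝ)) (x : Fin n → ℝ) : ℝ :=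
  sSup {r : ℝ | ∃ y : Fin n → ℝ, p y ≤ 1 ∧ r = |x ⬝ᵥ y|}

/-- The norm `max {‖c‖_*, ‖b‖_∞}` on the parameter space. The norm of a function type
is the supremum norm. -/
def paramNorm [Fintype ι] (p : Seminorm ℝ (Fin n → ℝ)) (w : (Fin n → ℝ) × (ι → ℝ)) : ℝ :=
  max (dualNorm p w.1) ‖w.2‖

/-- The operator norm of a matrix from `ℝⁿ × ℝ^ι`, with the norm `max {‖α‖_*, ‖β‖_∞}`, to `ℝⁿ` with
the norm `p`. -/
def matNorm [Fintype ι] (p : Seminorm ℝ (Fin n → ℝ)) (B : Matrix (Fin n) (Fin n ⊕ ι) ℝ) : ℝ :=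
  sSup {r : ℝ | ∃ (α : Fin n → ℝ) (β : ι → ℝ),
    paramNorm p (α, β) ≤ 1 ∧ r = p (B *ᵥ Sum.elim α β)}

/-- The distance from a point to a set with respect to the norm `p`; it is `∞` for the empty set. -/
def distTo (p : Seminorm ℝ (Fin n → ℝ)) (x : Fin n → ℝ) (s : Set (Fin n → ℝ)) : ℝ≥0∞ :=
  ⨅ y ∈ s, ENNReal.ofReal (p (x - y))

/-! ### Aubin property and Lipschitz modulus -/

/-- `κ` is a Lipschitz constant of the set-valued mapping `F` around `(w₀, x₀)`: for some
neighborhoods `V` of `w₀` and `U` of `x₀`, `d(x₂, F w₁) ≤ κ d(w₂, w₁)` whenever `w₁, w₂ ∈ V` and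
`x₂ ∈ F w₂ ∩ U`. Since all norms on a finite dimensional space are equivalent, neighborhoods are
those of the usual topology. -/
def IsLipConst [Fintype ι] (p : Seminorm ℝ (Fin n → ℝ))
    (F : (Fin n → ℝ) × (ι → ℝ) → Set (Fin n → ℝ))
    (w₀ : (Fin n → ℝ) × (ι → ℝ)) (x₀ : Fin n → ℝ) (κ : ℝ≥0) : Prop :=
  ∃ U ∈ 𝓝 x₀, ∃ V ∈ 𝓝 w₀, ∀ w₁ ∈ V, ∀ w₂ ∈ V, ∀ x₂ ∈ F w₂ ∩ U,
    distTo p x₂ (F w₁) ≤ (κ : ℝ≥0∞) * ENNReal.ofReal (paramNorm p (w₂ - w₁))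

/-- The Aubin property of `F` at `(w₀, x₀)`. -/
def HasAubin [Fintype ι] (p : Seminorm ℝ (Fin n → ℝ))
    (F : (Fin n → ℝ) × (ι → ℝ) → Set (Fin n → ℝ))
    (w₀ : (Fin n → ℝ) × (ι → ℝ)) (x₀ : Fin n → ℝ) : Prop :=
  ∃ κ : ℝ≥0, IsLipConst p F w₀ x₀ κ

/-- The Lipschitz modulus `lip F(w₀, x₀)`: the infimum of all Lipschitz constants, which is `∞`
when the Aubin property fails. -/
def lipModulus [Fintype ι] (p : Seminorm ℝ (Fin n → ℝ))
    (F : (Fin n → ℝ) × (ι → ℝ) → Set (Fin n → ℝ))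
    (w₀ : (Fin n → ℝ) × (ι → ℝ)) (x₀ : Fin n → ℝ) : ℝ≥0∞ :=
  ⨅ (κ : ℝ≥0) (_ : IsLipConst p F w₀ x₀ κ), (κ : ℝ≥0∞)

/-! ### KKT sets of indices and KKT matrices -/

/-- The set of active indices at `x`. -/
def activeSet (A : Matrix ι (Fin n) ℝ) (b : ι → ℝ) (x : Fin n → ℝ) : Set ι :=
  {i | A i ⬝ᵥ x = b i}

/-- The condition `-(Qx + c) ∈ cone {a_i : i ∈ D}`, where the cone always contains `0`. -/
def ConeCondition (Q : Matrix (Fin n) (Fin n) ℝ) (A : Matrix ι (Fin n) ℝ) (c x : Fin n → ℝ)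
    (D : Finset ι) : Prop :=
  -(Q *ᵥ x + c) ∈ PointedCone.hull ℝ ((fun i => A i) '' (D : Set ι))

/-- The family of minimal KKT sets of indices at `((c, b), x)`. -/
def minimalKKT (Q : Matrix (Fin n) (Fin n) ℝ) (A : Matrix ι (Fin n) ℝ) (c : Fin n → ℝ)
    (b : ι → ℝ) (x : Fin n → ℝ) : Set (Finset ι) :=
  {D | (D : Set ι) ⊆ activeSet A b x ∧ Minimal (ConeCondition Q A c x) D}

/-- The extended family of KKT sets of indices at `((c, b), x)`. -/
def extendedKKT (Q : Matrix (Fin n) (Fin n) ℝ) (A : Matrix ι (Fin n) ℝ) (c : Fin n → ℝ)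
    (b : ι → ℝ) (x : Fin n → ℝ) : Set (Finset ι) :=
  {D | (D : Set ι) ⊆ activeSet A b x ∧ LinearIndependent ℝ (fun i : D => A i) ∧
    ConeCondition Q A c x D}

/-- The matrix `M_D` with blocks `Q`, `A_D'`, `A_D`, `0`. -/
def kktMatrix (Q : Matrix (Fin n) (Fin n) ℝ) (A : Matrix ι (Fin n) ℝ) (D : Finset ι) :
    Matrix (Fin n ⊕ D) (Fin n ⊕ D) ℝ :=
  Matrix.fromBlocks Q (rows A D)ᵀ (rows A D) 0

/-- The matrix `(I_n 0) M_D⁻¹` (meaningful when `M_D` is nonsingular). -/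
def solutionMatrix [DecidableEq ι] (Q : Matrix (Fin n) (Fin n) ℝ) (A : Matrix ι (Fin n) ℝ)
    (D : Finset ι) : Matrix (Fin n) (Fin n ⊕ D) ℝ :=
  Matrix.fromCols (1 : Matrix (Fin n) (Fin n) ℝ) (0 : Matrix (Fin n) D ℝ) * (kktMatrix Q A D)⁻¹

end QuadArgmin

end

open QuadArgmin

namespace QuadArgmin

variable {n : ℕ} {ι : Type*}

/-! ### Homogeneous functions and norms on `ℝⁿ` -/

/-! Since the rows in `D₀` are independent, the multiplier vector at the reference point is unique.
Let `J` be its support. The subsets of `D₀` with the cone condition are exactly the `D` with `J ⊆ D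
⊆ D₀`, and `J` is the only minimal one (`exists_multiplier_support`). For independent rows, `M_D` is
nonsingular iff `Q` and `A_D` have no common nonzero kernel vector (`isUnit_kktMatrix_iff`). This
property passes to larger `D`, so everything reduces to `J`.

Aubin implies nonsingular: let `u ≠ 0` be in the common kernel. Relax the constraints outside `D` by
`ε` and tilt the cost by `s • u`. Every minimizer then lies on a relaxed constraint, at a distance
from the reference point that stays bounded below as `s → 0` (`HasAubin.kernelTrivial`).

Lower bound for the modulus: a shift of the parameter by order `ε` makes the constraints in `D`
strictly active and the others slack without moving the solution. Around the shifted parameter the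
solution moves linearly, through `(I 0) M_D⁻¹` (`IsLipConst.isReducedSolution_bound`).

Upper bound: turn the constraints in `J` into equalities. The resulting KKT pair exists for every
parameter and is globally Lipschitz (`exists_mixedKKT`, `MixedKKT.exists_lipschitz_bound`). Near the
reference parameter its multipliers on `J` stay positive, so it gives the unique minimizer. On a
segment of parameters, nearby solutions differ by a solution of some `M_D` system with `J ⊆ D`. The
local slopes are thus at most the largest matrix norm, and so is the total increment. -/

theorem exists_pos_mul_norm_pow_le {f : (Fin n → ℝ) → ℝ} (k : ℕ) (hf : Continuous f)
    (hpos : ∀ v, v ≠ 0 → 0 < f v) (h0 : 0 ≤ f 0)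
    (hhom : ∀ (r : ℝ) v, 0 < r → f (r • v) = r ^ k * f v) (hk : k ≠ 0) :
    ∃ μ > 0, ∀ v, μ * ‖v‖ ^ k ≤ f v := by
  have hμ : ∃ μ > 0, ∀ v, ‖v‖ = 1 → μ ≤ f v := by
    by_cases hne : (Metric.sphere (0 : Fin n → ℝ) 1).Nonempty
    · obtain ⟨v, hv, hmin⟩ :=
        (isCompact_sphere (0 : Fin n → ℝ) 1).exists_isMinOn hne hf.continuousOn
      have hv1 : ‖v‖ = 1 := by simpa using hv
      refine ⟨f v, hpos v ?_, fun w hw => hmin (by simpa using hw)⟩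
      rintro rfl
      simp at hv1
    -- The sphere is empty only in dimension zero, where any constant works.
    · exact ⟨1, one_pos, fun v hv => (hne ⟨v, by simpa using hv⟩).elim⟩
  obtain ⟨μ, hμ0, hμ⟩ := hμ
  refine ⟨μ, hμ0, fun v => ?_⟩
  by_cases hv : v = 0
  · subst hv
    simpa [hk] using h0
  · have hn : 0 < ‖v‖ := norm_pos_iff.2 hv
    have h1 := hμ (‖v‖⁻¹ • v) (by rw [norm_smul, norm_inv, norm_norm, inv_mul_cancel₀ hn.ne'])
    have h2 := hhom ‖v‖ (‖v‖⁻¹ • v) hn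
    rw [smul_smul, mul_inv_cancel₀ hn.ne', one_smul] at h2
    rw [h2, mul_comm]
    gcongr

theorem abs_dotProduct_le {κ : Type*} [Fintype κ] (u v : κ → ℝ) :
    |u ⬝ᵥ v| ≤ Fintype.card κ * (‖u‖ * ‖v‖) := by
  calc |u ⬝ᵥ v| ≤ ∑ i, |u i * v i| := Finset.abs_sum_le_sum_abs _ _
    _ ≤ ∑ _i : κ, ‖u‖ * ‖v‖ := by
        refine Finset.sum_le_sum fun i _ => ?_
        rw [abs_mul]
        exact mul_le_mul (norm_le_pi_norm u i) (norm_le_pi_norm v i) (abs_nonneg _) (norm_nonneg _)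
    _ = _ := by simp

theorem exists_mulVec_bound {κ κ' : Type*} [Fintype κ] [Fintype κ'] (B : Matrix κ κ' ℝ) :
    ∃ C : ℝ, 0 ≤ C ∧ ∀ v, ‖B *ᵥ v‖ ≤ C * ‖v‖ := by
  let f : (κ' → ℝ) →L[ℝ] (κ → ℝ) := LinearMap.toContinuousLinearMap (Matrix.mulVecLin B)
  exact ⟨‖f‖, norm_nonneg _, fun v => f.le_opNorm v⟩

theorem exists_seminorm_le (p : Seminorm ℝ (Fin n → ℝ)) :
    ∃ C : ℝ, 0 ≤ C ∧ ∀ v, p v ≤ C * ‖v‖ := by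
  refine ⟨∑ i, p (Pi.single i 1), Finset.sum_nonneg fun i _ => apply_nonneg _ _, fun v => ?_⟩
  have hv : v = ∑ i, v i • (Pi.single i 1 : Fin n → ℝ) := by
    ext j
    simp [Finset.sum_apply, Pi.single_apply]
  calc p v = p (∑ i, v i • (Pi.single i 1 : Fin n → ℝ)) := by rw [← hv]
    _ ≤ ∑ i, p (v i • (Pi.single i 1 : Fin n → ℝ)) :=
        Finset.le_sum_of_subadditive p (map_zero p).le (map_add_le_add p) _ _
    _ ≤ ∑ i, p (Pi.single i 1) * ‖v‖ := by
        refine Finset.sum_le_sum fun i _ => ?_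
        rw [map_smul_eq_mul, mul_comm]
        exact mul_le_mul_of_nonneg_left (norm_le_pi_norm v i) (apply_nonneg _ _)
    _ = _ := by rw [Finset.sum_mul]

theorem continuous_seminorm (p : Seminorm ℝ (Fin n → ℝ)) : Continuous p := by
  obtain ⟨C, hC, h⟩ := exists_seminorm_le p
  refine (LipschitzWith.of_dist_le_mul (K := C.toNNReal) fun u v => ?_).continuous
  rw [Real.dist_eq, dist_eq_norm, Real.coe_toNNReal _ hC]
  exact (abs_sub_map_le_sub p u v).trans (h _)

theorem exists_norm_le {p : Seminorm ℝ (Fin n → ℝ)} (hp : ∀ x, p x = 0 → x = 0) :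
    ∃ C : ℝ, 0 ≤ C ∧ ∀ v, ‖v‖ ≤ C * p v := by
  obtain ⟨μ, hμ, h⟩ := exists_pos_mul_norm_pow_le 1 (continuous_seminorm p)
    (fun v hv => (apply_nonneg p v).lt_of_ne fun h => hv (hp v h.symm)) (apply_nonneg _ _)
    (fun r v hr => by rw [map_smul_eq_mul, Real.norm_of_nonneg hr.le, pow_one]) one_ne_zero
  refine ⟨μ⁻¹, (inv_pos.2 hμ).le, fun v => ?_⟩
  have := h v
  rw [pow_one] at this
  rw [inv_mul_eq_div, le_div_iff₀ hμ, mul_comm]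
  exact this

theorem bddAbove_dualNorm {p : Seminorm ℝ (Fin n → ℝ)} (hp : ∀ x, p x = 0 → x = 0)
    (x : Fin n → ℝ) : BddAbove {r : ℝ | ∃ y : Fin n → ℝ, p y ≤ 1 ∧ r = |x ⬝ᵥ y|} := by
  obtain ⟨C, hC, h⟩ := exists_norm_le hp
  refine ⟨Fintype.card (Fin n) * (‖x‖ * (C * 1)), ?_⟩
  rintro r ⟨y, hy, rfl⟩
  refine (abs_dotProduct_le x y).trans ?_
  have := (h y).trans (mul_le_mul_of_nonneg_left hy hC)
  gcongr

theorem abs_dotProduct_le_dualNorm_mul {p : Seminorm ℝ (Fin n → ℝ)}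
    (hp : ∀ x, p x = 0 → x = 0) (x y : Fin n → ℝ) : |x ⬝ᵥ y| ≤ dualNorm p x * p y := by
  by_cases hy : y = 0
  · simp [hy]
  have hpy : 0 < p y := (apply_nonneg p y).lt_of_ne fun h => hy (hp y h.symm)
  have h1 : |x ⬝ᵥ ((p y)⁻¹ • y)| ≤ dualNorm p x := by
    refine le_csSup (bddAbove_dualNorm hp x) ⟨_, ?_, rfl⟩
    rw [map_smul_eq_mul, Real.norm_of_nonneg (inv_pos.2 hpy).le, inv_mul_cancel₀ hpy.ne']
  rw [dotProduct_smul, smul_eq_mul, abs_mul, abs_of_pos (inv_pos.2 hpy), inv_mul_eq_div,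
    div_le_iff₀ hpy] at h1
  exact h1

theorem dualNorm_nonneg (p : Seminorm ℝ (Fin n → ℝ)) (x : Fin n → ℝ) : 0 ≤ dualNorm p x := by
  refine Real.sSup_nonneg ?_
  rintro r ⟨y, -, rfl⟩
  exact abs_nonneg _

open scoped Pointwise in
theorem dualNorm_smul (p : Seminorm ℝ (Fin n → ℝ)) (r : ℝ) (x : Fin n → ℝ) :
    dualNorm p (r • x) = |r| * dualNorm p x := by
  have : {s : ℝ | ∃ y : Fin n → ℝ, p y ≤ 1 ∧ s = |(r • x) ⬝ᵥ y|} =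
      |r| • {s : ℝ | ∃ y : Fin n → ℝ, p y ≤ 1 ∧ s = |x ⬝ᵥ y|} := by
    ext s
    simp only [Set.mem_ofPred_eq, Set.mem_smul_set, smul_eq_mul, smul_dotProduct, abs_mul]
    constructor
    · rintro ⟨y, hy, rfl⟩
      exact ⟨_, ⟨y, hy, rfl⟩, rfl⟩
    · rintro ⟨_, ⟨y, hy, rfl⟩, rfl⟩
      exact ⟨y, hy, rfl⟩
  unfold dualNorm
  rw [this, Real.sSup_smul_of_nonneg (abs_nonneg r), smul_eq_mul]

theorem dualNorm_neg (p : Seminorm ℝ (Fin n → ℝ)) (x : Fin n → ℝ) :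
    dualNorm p (-x) = dualNorm p x := by
  simpa using dualNorm_smul p (-1) x

/-! ### Norms on the parameter space and the operator norm -/

section Param

variable [Fintype ι]

theorem paramNorm_nonneg (p : Seminorm ℝ (Fin n → ℝ)) (w : (Fin n → ℝ) × (ι → ℝ)) :
    0 ≤ paramNorm p w :=
  (norm_nonneg w.2).trans (le_max_right _ _)

theorem paramNorm_smul (p : Seminorm ℝ (Fin n → ℝ)) (r : ℝ) (w : (Fin n → ℝ) × (ι → ℝ)) :
    paramNorm p (r • w) = |r| * paramNorm p w := by
  unfold paramNorm
  rw [Prod.smul_fst, Prod.smul_snd, dualNorm_smul, norm_smul, Real.norm_eq_abs,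
    mul_max_of_nonneg _ _ (abs_nonneg r)]

theorem paramNorm_neg_fst (p : Seminorm ℝ (Fin n → ℝ)) (α : Fin n → ℝ) (β : ι → ℝ) :
    paramNorm p (-α, β) = paramNorm p (α, β) := by
  simp only [paramNorm, dualNorm_neg]

theorem exists_norm_le_paramNorm {p : Seminorm ℝ (Fin n → ℝ)} (hp : ∀ x, p x = 0 → x = 0) :
    ∃ C : ℝ, 0 ≤ C ∧ ∀ (α : Fin n → ℝ) (β : ι → ℝ),
      ‖Sum.elim α β‖ ≤ C * paramNorm p (α, β) := by
  -- A coordinate of `α` is its product with a unit vector, at most the dual norm times `p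
  -- (Pi.single i 1)`; the summand `1` serves `β`.
  refine ⟨1 + ∑ i, p (Pi.single i 1), by positivity, fun α β => ?_⟩
  have hw := paramNorm_nonneg p (α, β)
  have hs : 0 ≤ ∑ i, p (Pi.single i 1) := by positivity
  rw [pi_norm_le_iff_of_nonneg (by positivity)]
  rintro (i | i)
  · have h1 := abs_dotProduct_le_dualNorm_mul hp α (Pi.single i 1)
    rw [dotProduct_single_one] at h1
    have h2 : p (Pi.single i 1) ≤ ∑ i, p (Pi.single i 1) :=
      Finset.single_le_sum (f := fun i => p (Pi.single i 1)) (fun i _ => apply_nonneg _ _)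
        (Finset.mem_univ i)
    have h3 : dualNorm p α ≤ paramNorm p (α, β) := le_max_left _ _
    have h4 := mul_le_mul h3 h2 (apply_nonneg _ _) hw
    simp only [Sum.elim_inl, Real.norm_eq_abs]
    linarith
  · have h1 : ‖β i‖ ≤ paramNorm p (α, β) := (norm_le_pi_norm β i).trans (le_max_right _ _)
    simp only [Sum.elim_inr]
    nlinarith

theorem bddAbove_matNorm {p : Seminorm ℝ (Fin n → ℝ)} (hp : ∀ x, p x = 0 → x = 0)
    (B : Matrix (Fin n) (Fin n ⊕ ι) ℝ) :
    BddAbove {r : ℝ | ∃ (α : Fin n → ℝ) (β : ι → ℝ),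
      paramNorm p (α, β) ≤ 1 ∧ r = p (B *ᵥ Sum.elim α β)} := by
  obtain ⟨C₁, hC₁, h₁⟩ := exists_seminorm_le p
  obtain ⟨C₂, hC₂, h₂⟩ := exists_mulVec_bound B
  obtain ⟨C₃, hC₃, h₃⟩ := exists_norm_le_paramNorm (ι := ι) hp
  refine ⟨C₁ * (C₂ * (C₃ * 1)), ?_⟩
  rintro r ⟨α, β, hw, rfl⟩
  refine (h₁ _).trans ?_
  gcongr
  refine (h₂ _).trans ?_
  gcongr
  refine (h₃ _ _).trans ?_
  gcongr

theorem matNorm_nonneg (p : Seminorm ℝ (Fin n → ℝ)) (B : Matrix (Fin n) (Fin n ⊕ ι) ℝ) :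
    0 ≤ matNorm p B := by
  refine Real.sSup_nonneg ?_
  rintro r ⟨α, β, -, rfl⟩
  exact apply_nonneg _ _

theorem le_matNorm_mul {p : Seminorm ℝ (Fin n → ℝ)} (hp : ∀ x, p x = 0 → x = 0)
    (B : Matrix (Fin n) (Fin n ⊕ ι) ℝ) (α : Fin n → ℝ) (β : ι → ℝ) :
    p (B *ᵥ Sum.elim α β) ≤ matNorm p B * paramNorm p (α, β) := by
  rcases (paramNorm_nonneg p (α, β)).eq_or_lt with h0 | hpos
  · obtain ⟨C, -, h⟩ := exists_norm_le_paramNorm (ι := ι) hp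
    have h1 := h α β
    rw [← h0, mul_zero, norm_le_zero_iff] at h1
    rw [h1, ← h0]
    simp
  · set r := paramNorm p (α, β) with hr
    have h1 : p (B *ᵥ Sum.elim (r⁻¹ • α) (r⁻¹ • β)) ≤ matNorm p B := by
      refine le_csSup (bddAbove_matNorm hp B) ⟨_, _, ?_, rfl⟩
      rw [← Prod.smul_mk, paramNorm_smul, abs_of_pos (inv_pos.2 hpos), ← hr,
        inv_mul_cancel₀ hpos.ne']
    have h2 : Sum.elim (r⁻¹ • α) (r⁻¹ • β) = r⁻¹ • Sum.elim α β := by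
      ext (i | i) <;> simp
    rw [h2, Matrix.mulVec_smul, map_smul_eq_mul, Real.norm_of_nonneg (inv_pos.2 hpos).le,
      inv_mul_eq_div, div_le_iff₀ hpos] at h1
    exact h1

theorem matNorm_le {p : Seminorm ℝ (Fin n → ℝ)} {B : Matrix (Fin n) (Fin n ⊕ ι) ℝ} {K : ℝ}
    (hK : 0 ≤ K)
    (h : ∀ (α : Fin n → ℝ) (β : ι → ℝ), p (B *ᵥ Sum.elim α β) ≤ K * paramNorm p (α, β)) :
    matNorm p B ≤ K := by
  refine Real.sSup_le ?_ hK
  rintro r ⟨α, β, hw, rfl⟩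
  refine (h α β).trans ?_
  calc K * paramNorm p (α, β) ≤ K * 1 := by gcongr
    _ = K := mul_one K

end Param

/-- A path whose right slopes are locally bounded by `L` has total increment at most `L`. -/
theorem seminorm_sub_le_of_forall_right (p : Seminorm ℝ (Fin n → ℝ)) {f : ℝ → Fin n → ℝ}
    (hf : Continuous f) {L : ℝ}
    (h : ∀ t ∈ Set.Ico (0 : ℝ) 1, ∀ᶠ s in 𝓝[>] t, p (f s - f t) ≤ L * (s - t)) :
    p (f 1 - f 0) ≤ L := by
  have hp := continuous_seminorm p
  have hsub : Set.Icc (0 : ℝ) 1 ⊆ {t | p (f t - f 0) ≤ L * t} := by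
    -- Continuous induction: the set where the bound holds is closed, contains `0`, and extends to
    -- the right of each of its points before `1`.
    refine IsClosed.Icc_subset_of_forall_mem_nhdsWithin ?_ ?_ ?_
    · exact (isClosed_le (by fun_prop) (by fun_prop)).inter isClosed_Icc
    · simp
    · rintro t ⟨ht, htI⟩
      filter_upwards [h t htI] with s hs
      have h1 : p (f s - f 0) ≤ p (f s - f t) + p (f t - f 0) := by
        simpa using map_add_le_add p (f s - f t) (f t - f 0)
      simp only [Set.mem_ofPred_eq] at ht ⊢
      linarith
  simpa using hsub (Set.right_mem_Icc.2 zero_le_one)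

/-! ### Optimality conditions -/

section KKT

variable {Q : Matrix (Fin n) (Fin n) ℝ} {A : Matrix ι (Fin n) ℝ}

/-- `Q` and `A_D` have no common kernel vector except `0`. -/
def KernelTrivial (Q : Matrix (Fin n) (Fin n) ℝ) (A : Matrix ι (Fin n) ℝ) (D : Set ι) : Prop :=
  ∀ u : Fin n → ℝ, Q *ᵥ u = 0 → (∀ i ∈ D, A i ⬝ᵥ u = 0) → u = 0

theorem KernelTrivial.mono {D E : Set ι} (h : KernelTrivial Q A D) (hDE : D ⊆ E) :
    KernelTrivial Q A E :=
  fun u hu hA => h u hu fun i hi => hA i (hDE hi)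

variable [Fintype ι]

/-- The optimality conditions of the quadratic program in which the constraints with index in `J`
are equalities, so that their multipliers are free. -/
structure MixedKKT (Q : Matrix (Fin n) (Fin n) ℝ) (A : Matrix ι (Fin n) ℝ) (J : Set ι)
    (w : (Fin n → ℝ) × (ι → ℝ)) (y : Fin n → ℝ) (l : ι → ℝ) : Prop where
  stationary : Q *ᵥ y + w.1 + l ᵥ* A = 0
  feasible : ∀ i, A i ⬝ᵥ y ≤ w.2 i
  complementary : ∀ i, l i * (w.2 i - A i ⬝ᵥ y) = 0
  active : ∀ i ∈ J, A i ⬝ᵥ y = w.2 i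
  nonneg : ∀ i ∉ J, 0 ≤ l i

/-- `y` is the first block of a solution of the linear system with matrix `M_D` and right-hand side
`(α, β_D)`. -/
def IsReducedSolution (Q : Matrix (Fin n) (Fin n) ℝ) (A : Matrix ι (Fin n) ℝ) (D : Set ι)
    (α : Fin n → ℝ) (β : ι → ℝ) (y : Fin n → ℝ) : Prop :=
  ∃ μ : ι → ℝ, (∀ i ∉ D, μ i = 0) ∧ Q *ᵥ y + μ ᵥ* A = α ∧ ∀ i ∈ D, A i ⬝ᵥ y = β i

theorem dotProduct_mulVec_comm (hQ : Q.PosSemidef) (u v : Fin n → ℝ) :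
    u ⬝ᵥ (Q *ᵥ v) = (Q *ᵥ u) ⬝ᵥ v := by
  have hT : Qᵀ = Q := by simpa [Matrix.IsHermitian] using hQ.1
  rw [Matrix.dotProduct_mulVec, ← Matrix.mulVec_transpose, hT]

theorem dotProduct_mulVec_self_nonneg (hQ : Q.PosSemidef) (v : Fin n → ℝ) :
    0 ≤ v ⬝ᵥ (Q *ᵥ v) := by
  simpa using hQ.dotProduct_mulVec_nonneg v

theorem mulVec_eq_zero_of_dotProduct (hQ : Q.PosSemidef) {v : Fin n → ℝ}
    (h : v ⬝ᵥ (Q *ᵥ v) = 0) : Q *ᵥ v = 0 :=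
  (hQ.dotProduct_mulVec_zero_iff v).1 (by simpa using h)

theorem objective_add (hQ : Q.PosSemidef) (c y d : Fin n → ℝ) :
    objective Q c (y + d) =
      objective Q c y + (Q *ᵥ y + c) ⬝ᵥ d + (1 / 2 : ℝ) * (d ⬝ᵥ (Q *ᵥ d)) := by
  have h := dotProduct_mulVec_comm hQ y d
  simp only [objective, Matrix.mulVec_add, dotProduct_add, add_dotProduct, h]
  rw [dotProduct_comm d (Q *ᵥ y)]
  ring

theorem vecMul_dotProduct_eq_sum (l : ι → ℝ) (v : Fin n → ℝ) :
    (l ᵥ* A) ⬝ᵥ v = ∑ i, l i * (A i ⬝ᵥ v) := by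
  rw [← Matrix.dotProduct_mulVec]
  rfl

/-- The second-order expansion is exact. Stationarity expresses its linear term through the
multipliers, and complementarity rewrites that as multipliers times the slacks of `y + d`. With
nonnegative multipliers, both correction terms are nonnegative at feasible points. -/
theorem MixedKKT.objective_eq (hQ : Q.PosSemidef) {J : Set ι} {w : (Fin n → ℝ) × (ι → ℝ)}
    {y : Fin n → ℝ} {l : ι → ℝ} (h : MixedKKT Q A J w y l) (d : Fin n → ℝ) :
    objective Q w.1 (y + d) = objective Q w.1 y + ∑ i, l i * (w.2 i - A i ⬝ᵥ (y + d)) +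
      (1 / 2 : ℝ) * (d ⬝ᵥ (Q *ᵥ d)) := by
  rw [objective_add hQ, eq_neg_of_add_eq_zero_left h.stationary, neg_dotProduct,
    vecMul_dotProduct_eq_sum, ← Finset.sum_neg_distrib]
  congr 2
  refine Finset.sum_congr rfl fun i _ => ?_
  have := h.complementary i
  rw [dotProduct_add]
  linarith

/-- A second minimizer makes both correction terms of `objective_eq` vanish. Its difference to `y`
is then in the kernel of `Q`, and both points are active on `D`, so the difference lies in the
common kernel. -/
theorem MixedKKT.argminMap_eq (hQ : Q.PosSemidef) {w : (Fin n → ℝ) × (ι → ℝ)}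
    {y : Fin n → ℝ} {l : ι → ℝ} (h : MixedKKT Q A ∅ w y l) {D : Set ι}
    (hD : KernelTrivial Q A D) (hl : ∀ i ∈ D, 0 < l i) : argminMap Q A w = {y} := by
  have hl0 : ∀ i, 0 ≤ l i := fun i => h.nonneg i (Set.notMem_empty i)
  have key : ∀ z ∈ QuadArgmin.feasible A w.2, 0 ≤ ∑ i, l i * (w.2 i - A i ⬝ᵥ (y + (z - y))) := by
    intro z hz
    refine Finset.sum_nonneg fun i _ => mul_nonneg (hl0 i) ?_
    rw [add_sub_cancel]
    exact sub_nonneg.2 (hz i)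
  have hy : y ∈ argminMap Q A w := by
    refine ⟨h.feasible, fun z hz => ?_⟩
    have h1 := h.objective_eq hQ (z - y)
    have h2 := key z hz
    have h3 := dotProduct_mulVec_self_nonneg hQ (z - y)
    rw [add_sub_cancel] at h1 h2
    linarith
  refine Set.eq_singleton_iff_unique_mem.2 ⟨hy, fun z hz => ?_⟩
  have h1 := h.objective_eq hQ (z - y)
  have h2 := key z hz.1
  have h3 := dotProduct_mulVec_self_nonneg hQ (z - y)
  have h4 := hz.2 y h.feasible
  rw [add_sub_cancel] at h1 h2
  have h5 : ∑ i, l i * (w.2 i - A i ⬝ᵥ z) = 0 := by linarith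
  have h6 : (z - y) ⬝ᵥ (Q *ᵥ (z - y)) = 0 := by linarith
  refine sub_eq_zero.1 (hD _ (mulVec_eq_zero_of_dotProduct hQ h6) fun i hi => ?_)
  have h7 := (Finset.sum_eq_zero_iff_of_nonneg fun i _ =>
    mul_nonneg (hl0 i) (sub_nonneg.2 (hz.1 i))).1 h5 i (Finset.mem_univ i)
  have h8 := h.complementary i
  have h9 := (mul_eq_zero.1 h7).resolve_left (hl i hi).ne'
  have h10 := (mul_eq_zero.1 h8).resolve_left (hl i hi).ne'
  rw [dotProduct_sub]
  linarith

/-! ### Existence and Lipschitz dependence for the problem with equality constraints -/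

/-- The squares over `J` supply the curvature that `Q` lacks; in the mixed problem they are
controlled by the right-hand side, since those constraints are equalities. -/
theorem exists_quadratic_lower_bound (hQ : Q.PosSemidef) {J : Set ι} (hJ : KernelTrivial Q A J) :
    ∃ μ > 0, ∀ v : Fin n → ℝ,
      μ * ‖v‖ ^ 2 ≤ v ⬝ᵥ (Q *ᵥ v) + ∑ i, J.indicator (fun i => (A i ⬝ᵥ v) ^ 2) i := by
  have hnn : ∀ v : Fin n → ℝ, ∀ i, 0 ≤ J.indicator (fun i => (A i ⬝ᵥ v) ^ 2) i :=
    fun v i => Set.indicator_nonneg (fun i _ => sq_nonneg _) i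
  refine exists_pos_mul_norm_pow_le 2 ?_ ?_ ?_ ?_ two_ne_zero
  · refine Continuous.add (by fun_prop) (continuous_finsetSum _ fun i _ => ?_)
    by_cases hi : i ∈ J
    · simp only [Set.indicator_of_mem hi]
      fun_prop
    · simp only [Set.indicator_of_notMem hi]
      fun_prop
  · intro v hv
    have h1 := dotProduct_mulVec_self_nonneg hQ v
    have h2 : 0 ≤ ∑ i, J.indicator (fun i => (A i ⬝ᵥ v) ^ 2) i :=
      Finset.sum_nonneg fun i _ => hnn v i
    refine (add_nonneg h1 h2).lt_of_ne fun h0 => hv ?_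
    refine hJ v (mulVec_eq_zero_of_dotProduct hQ (by linarith)) fun i hi => ?_
    have h3 := (Finset.sum_eq_zero_iff_of_nonneg fun i _ => hnn v i).1
      (by linarith) i (Finset.mem_univ i)
    rw [Set.indicator_of_mem hi] at h3
    exact pow_eq_zero_iff two_ne_zero |>.1 h3
  · simp
  · intro r v _
    rw [Matrix.mulVec_smul, dotProduct_smul, smul_dotProduct, mul_add, Finset.mul_sum]
    congr 1
    · simp only [smul_eq_mul]
      ring
    · refine Finset.sum_congr rfl fun i _ => ?_
      by_cases hi : i ∈ J
      · simp only [Set.indicator_of_mem hi, dotProduct_smul, smul_eq_mul]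
        ring
      · simp only [Set.indicator_of_notMem hi, mul_zero]

/-- Monotonicity of complementarity: with slacks `s₁`, `s₂`, a term outside `J` equals `l₁ s₂ + l₂
s₁ ≥ 0`, and on `J` all slacks vanish. -/
theorem MixedKKT.dotProduct_sub_nonneg {J : Set ι} {w₁ w₂ : (Fin n → ℝ) × (ι → ℝ)}
    {y₁ y₂ : Fin n → ℝ} {l₁ l₂ : ι → ℝ} (h₁ : MixedKKT Q A J w₁ y₁ l₁)
    (h₂ : MixedKKT Q A J w₂ y₂ l₂) :
    0 ≤ (l₁ - l₂) ⬝ᵥ (A *ᵥ (y₁ - y₂) - (w₁.2 - w₂.2)) := by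
  refine Finset.sum_nonneg fun i _ => ?_
  have hA : (A *ᵥ (y₁ - y₂)) i = A i ⬝ᵥ y₁ - A i ⬝ᵥ y₂ := dotProduct_sub _ _ _
  simp only [Pi.sub_apply, hA]
  by_cases hi : i ∈ J
  · rw [h₁.active i hi, h₂.active i hi, sub_self, mul_zero]
  · have e₁ := h₁.complementary i
    have e₂ := h₂.complementary i
    have n₁ := mul_nonneg (h₁.nonneg i hi) (sub_nonneg.2 (h₂.feasible i))
    have n₂ := mul_nonneg (h₂.nonneg i hi) (sub_nonneg.2 (h₁.feasible i))
    nlinarith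

variable [DecidableEq ι]

/-- The right inverse `R` recovers the multiplier difference from stationarity, so it is controlled
by `d` and `W`. Monotonicity bounds `d'Qd`, and coercivity then gives `μ‖d‖² ≤ a‖d‖W + bW²`. -/
theorem MixedKKT.exists_lipschitz_bound (hQ : Q.PosSemidef) {R : Matrix (Fin n) ι ℝ}
    (hR : A * R = 1) {J : Set ι} (hJ : KernelTrivial Q A J) :
    ∃ C : ℝ, 0 ≤ C ∧ ∀ w₁ w₂ y₁ y₂ l₁ l₂, MixedKKT Q A J w₁ y₁ l₁ → MixedKKT Q A J w₂ y₂ l₂ →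
      ‖y₁ - y₂‖ ≤ C * ‖w₁ - w₂‖ ∧ ‖l₁ - l₂‖ ≤ C * ‖w₁ - w₂‖ := by
  obtain ⟨μ, hμ, hlow⟩ := exists_quadratic_lower_bound hQ hJ
  obtain ⟨C₀, hC₀, h₀⟩ := exists_mulVec_bound Q
  obtain ⟨C₁, hC₁, h₁⟩ := exists_mulVec_bound Rᵀ
  set N : ℝ := (Fintype.card ι : ℝ)
  set k : ℝ := (Fintype.card (Fin n) : ℝ)
  have hN : 0 ≤ N := Nat.cast_nonneg _
  have hk : 0 ≤ k := Nat.cast_nonneg _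
  set a : ℝ := k + N * (C₁ * C₀)
  set b : ℝ := N * C₁ + N
  have ha : 0 ≤ a := by positivity
  have hb : 0 ≤ b := by positivity
  -- The `1` covers the case `‖d‖ ≤ W`. Otherwise `W² ≤ W‖d‖`, and dividing the quadratic inequality
  -- by `‖d‖` gives `(a + b) / μ`.
  set C₂ : ℝ := 1 + (a + b) / μ
  have hC₂ : 0 ≤ C₂ := by positivity
  refine ⟨C₂ + C₁ * (C₀ * C₂ + 1), by positivity, ?_⟩
  intro w₁ w₂ y₁ y₂ l₁ l₂ k₁ k₂
  have hmono := k₁.dotProduct_sub_nonneg k₂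
  set d := y₁ - y₂ with hd
  set e := l₁ - l₂ with he
  set γ := w₁.1 - w₂.1 with hγ
  set β := w₁.2 - w₂.2 with hβ
  set W := ‖w₁ - w₂‖ with hW
  have hγW : ‖γ‖ ≤ W := norm_fst_le (w₁ - w₂)
  have hβW : ‖β‖ ≤ W := norm_snd_le (w₁ - w₂)
  have hW0 : 0 ≤ W := norm_nonneg _
  have hstat : Q *ᵥ d + γ + e ᵥ* A = 0 := by
    have := congrArg₂ (· - ·) k₁.stationary k₂.stationary
    simp only [sub_zero] at this
    rw [← this, hd, hγ, he, Matrix.mulVec_sub, Matrix.sub_vecMul]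
    abel
  have heq : e = Rᵀ *ᵥ (-(Q *ᵥ d + γ)) := by
    rw [← eq_neg_of_add_eq_zero_right hstat, Matrix.mulVec_transpose, Matrix.vecMul_vecMul, hR,
      Matrix.vecMul_one]
  have hebound : ‖e‖ ≤ C₁ * (C₀ * ‖d‖ + W) := by
    rw [heq]
    refine (h₁ _).trans ?_
    rw [norm_neg]
    gcongr
    exact (norm_add_le _ _).trans (add_le_add (h₀ d) hγW)
  have hquad : d ⬝ᵥ (Q *ᵥ d) ≤ -(γ ⬝ᵥ d) - e ⬝ᵥ β := by
    rw [dotProduct_sub, Matrix.dotProduct_mulVec] at hmono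
    have h2 : (Q *ᵥ d + γ + e ᵥ* A) ⬝ᵥ d = 0 := by rw [hstat, zero_dotProduct]
    rw [add_dotProduct, add_dotProduct] at h2
    rw [dotProduct_comm d]
    linarith
  have hsum : ∑ i, J.indicator (fun i => (A i ⬝ᵥ d) ^ 2) i ≤ N * W ^ 2 := by
    calc ∑ i, J.indicator (fun i => (A i ⬝ᵥ d) ^ 2) i ≤ ∑ _i : ι, W ^ 2 := by
          refine Finset.sum_le_sum fun i _ => ?_
          by_cases hi : i ∈ J
          · have hAd : A i ⬝ᵥ d = β i := by
              rw [hd, dotProduct_sub, k₁.active i hi, k₂.active i hi]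
              rfl
            rw [Set.indicator_of_mem hi, hAd, ← sq_abs]
            have : |β i| ≤ W := (norm_le_pi_norm β i).trans hβW
            gcongr
          · rw [Set.indicator_of_notMem hi]
            positivity
      _ = N * W ^ 2 := by simp [N]
  have hγd : -(γ ⬝ᵥ d) ≤ k * (W * ‖d‖) :=
    (neg_le_abs _).trans ((abs_dotProduct_le γ d).trans (by gcongr))
  have heβ : -(e ⬝ᵥ β) ≤ N * (C₁ * (C₀ * ‖d‖ + W) * W) :=
    (neg_le_abs _).trans ((abs_dotProduct_le e β).trans (by gcongr))
  have hfin : μ * ‖d‖ ^ 2 ≤ a * ‖d‖ * W + b * W ^ 2 := by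
    have := hlow d
    have e1 : a * ‖d‖ * W + b * W ^ 2 =
      k * (W * ‖d‖) + N * (C₁ * (C₀ * ‖d‖ + W) * W) + N * W ^ 2 := by
        simp only [a, b]
        ring
    rw [e1]
    linarith
  have hdW : ‖d‖ ≤ C₂ * W := by
    rcases le_or_gt ‖d‖ W with hle | hlt
    · have : 0 ≤ (a + b) / μ * W := by positivity
      simp only [C₂]
      linarith
    · have hd0 : 0 < ‖d‖ := hW0.trans_lt hlt
      have h3 : μ * ‖d‖ * ‖d‖ ≤ (a + b) * W * ‖d‖ := by
        have : b * W ^ 2 ≤ b * (W * ‖d‖) := by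
          rw [sq]
          gcongr
        nlinarith
      have h4 := le_of_mul_le_mul_right h3 hd0
      have h5 : ‖d‖ ≤ (a + b) / μ * W := by
        rw [div_mul_eq_mul_div, le_div_iff₀ hμ, mul_comm]
        exact h4
      simp only [C₂]
      linarith
  have heW : ‖e‖ ≤ C₁ * (C₀ * C₂ + 1) * W := by
    refine hebound.trans ?_
    have h6 : C₁ * (C₀ * ‖d‖ + W) ≤ C₁ * (C₀ * (C₂ * W) + W) := by gcongr
    linarith
  have h7 : 0 ≤ C₂ * W := by positivity
  have h8 : 0 ≤ C₁ * (C₀ * C₂ + 1) * W := by positivity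
  rw [add_mul]
  exact ⟨by linarith, by linarith⟩

theorem nonneg_of_forall_quadratic_nonneg {g k : ℝ}
    (h : ∀ t, 0 < t → t ≤ 1 → 0 ≤ t * g + t ^ 2 * k) : 0 ≤ g := by
  have hlim : Filter.Tendsto (fun t : ℝ => g + t * k) (𝓝[>] 0) (𝓝 (g + 0 * k)) :=
    Filter.Tendsto.mono_left (Continuous.tendsto (by fun_prop) 0) nhdsWithin_le_nhds
  rw [zero_mul, add_zero] at hlim
  refine ge_of_tendsto hlim ?_
  filter_upwards [Ioc_mem_nhdsGT (one_pos : (0 : ℝ) < 1)] with t ht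
  have h1 := h t ht.1 ht.2
  have h2 : t * g + t ^ 2 * k = t * (g + t * k) := by ring
  rw [h2] at h1
  exact nonneg_of_mul_nonneg_right h1 ht.1

/-- A minimizer exists by coercivity on the feasible set. Column `i` of `R` changes only the value
of constraint `i`, so the multipliers are minus the derivatives of the objective along these
columns. -/
theorem exists_mixedKKT (hQ : Q.PosSemidef) {R : Matrix (Fin n) ι ℝ} (hR : A * R = 1) {J : Set ι}
    (hJ : KernelTrivial Q A J) (w : (Fin n → ℝ) × (ι → ℝ)) :
    ∃ y l, MixedKKT Q A J w y l := by
  obtain ⟨μ, hμ, hlow⟩ := exists_quadratic_lower_bound hQ hJ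
  set s : Set (Fin n → ℝ) := {y | (∀ i, A i ⬝ᵥ y ≤ w.2 i) ∧ ∀ i ∈ J, A i ⬝ᵥ y = w.2 i} with hs
  have hAR : ∀ (v : ι → ℝ) i, A i ⬝ᵥ (R *ᵥ v) = v i := fun v i => by
    have : A *ᵥ (R *ᵥ v) = v := by rw [Matrix.mulVec_mulVec, hR, Matrix.one_mulVec]
    exact congrFun this i
  have hclosed : IsClosed s := by
    have e : s = (⋂ i, {y | A i ⬝ᵥ y ≤ w.2 i}) ∩ ⋂ i ∈ J, {y | A i ⬝ᵥ y = w.2 i} := by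
      ext y
      simp [hs]
    rw [e]
    refine (isClosed_iInter fun i => isClosed_le (by fun_prop) (by fun_prop)).inter ?_
    exact isClosed_iInter fun i => isClosed_iInter fun _ => isClosed_eq (by fun_prop) (by fun_prop)
  have hx₀ : R *ᵥ w.2 ∈ s := ⟨fun i => (hAR _ i).le, fun i _ => hAR _ i⟩
  have hcont : Continuous (objective Q w.1) := by
    unfold objective
    fun_prop
  obtain ⟨y, hys, hmin⟩ : ∃ y ∈ s, IsMinOn (objective Q w.1) s y := by
    refine hcont.continuousOn.exists_isMinOn' hclosed hx₀ ?_
    set F := objective Q w.1 (R *ᵥ w.2)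
    set B : ℝ := ∑ i, J.indicator (fun i => w.2 i ^ 2) i
    set k : ℝ := Fintype.card (Fin n) * ‖w.1‖
    -- The radius makes `μ / 2 * ‖z‖` dominate `k + |B| / 2 + |F|`, so the objective is at least `F`
    -- outside the ball.
    have hbig := (tendsto_norm_cocompact_atTop (E := Fin n → ℝ)).eventually
      (Filter.eventually_ge_atTop (max 1 (2 / μ * (k + |B| / 2 + |F|))))
    filter_upwards [Filter.mem_inf_of_left hbig, Filter.mem_inf_of_right
      (Filter.mem_principal_self s)] with z hz hzs
    have hz1 : 1 ≤ ‖z‖ := (le_max_left _ _).trans hz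
    have hz2 : 2 / μ * (k + |B| / 2 + |F|) ≤ ‖z‖ := (le_max_right _ _).trans hz
    have h1 := hlow z
    have h2 : ∑ i, J.indicator (fun i => (A i ⬝ᵥ z) ^ 2) i = B := by
      refine Finset.sum_congr rfl fun i _ => ?_
      by_cases hi : i ∈ J
      · rw [Set.indicator_of_mem hi, Set.indicator_of_mem hi, hzs.2 i hi]
      · rw [Set.indicator_of_notMem hi, Set.indicator_of_notMem hi]
    have h3 : -(w.1 ⬝ᵥ z) ≤ k * ‖z‖ :=
      (neg_le_abs _).trans ((abs_dotProduct_le w.1 z).trans (by rw [← mul_assoc]))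
    have h4 : k + |B| / 2 + |F| ≤ μ / 2 * ‖z‖ := by
      have := mul_le_mul_of_nonneg_left hz2 (half_pos hμ).le
      rw [← mul_assoc] at this
      have e : μ / 2 * (2 / μ) = 1 := by field_simp
      rwa [e, one_mul] at this
    have h5 := mul_le_mul_of_nonneg_right h4 (zero_le_one.trans hz1)
    have h6 : |B| / 2 + |F| ≤ (|B| / 2 + |F|) * ‖z‖ := le_mul_of_one_le_right (by positivity) hz1
    have h7 := le_abs_self B
    have h8 := le_abs_self F
    have h9 : objective Q w.1 z = 1 / 2 * (z ⬝ᵥ (Q *ᵥ z)) + w.1 ⬝ᵥ z := rfl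
    rw [h9]
    nlinarith
  set g := Q *ᵥ y + w.1 with hg
  have hfirst : ∀ d, y + d ∈ s → 0 ≤ g ⬝ᵥ d := by
    intro d hd
    refine nonneg_of_forall_quadratic_nonneg (k := 1 / 2 * (d ⬝ᵥ (Q *ᵥ d))) fun t ht0 ht1 => ?_
    have hmem : y + t • d ∈ s := by
      refine ⟨fun i => ?_, fun i hi => ?_⟩
      · have e1 := hys.1 i
        have e2 := hd.1 i
        rw [dotProduct_add] at e2 ⊢
        rw [dotProduct_smul, smul_eq_mul]
        nlinarith
      · have e1 := hys.2 i hi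
        have e2 := hd.2 i hi
        rw [dotProduct_add] at e2 ⊢
        rw [dotProduct_smul, smul_eq_mul, e1, show A i ⬝ᵥ d = 0 by linarith, mul_zero, add_zero]
    have h1 : objective Q w.1 y ≤ objective Q w.1 (y + t • d) := hmin hmem
    rw [objective_add hQ, Matrix.mulVec_smul, dotProduct_smul, dotProduct_smul, smul_dotProduct,
      ← hg] at h1
    simp only [smul_eq_mul] at h1
    nlinarith
  have hdot : ∀ v, ((-g) ᵥ* R) ⬝ᵥ v = -(g ⬝ᵥ (R *ᵥ v)) := fun v => by
    rw [← Matrix.dotProduct_mulVec, neg_dotProduct]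
  have hlam : ∀ i, ((-g) ᵥ* R) i = -(g ⬝ᵥ (R *ᵥ Pi.single i 1)) := fun i => by
    rw [← hdot, dotProduct_single_one]
  refine ⟨y, (-g) ᵥ* R, ?_, hys.1, ?_, hys.2, ?_⟩
  · rw [← hg]
    refine dotProduct_eq_zero _ fun v => ?_
    rw [add_dotProduct, ← Matrix.dotProduct_mulVec, hdot]
    -- The component of `v` in the kernel of `A` may be followed in both directions, so `g`
    -- annihilates it.
    have hker : ∀ i, A i ⬝ᵥ (v - R *ᵥ (A *ᵥ v)) = 0 := fun i => by
      rw [dotProduct_sub, hAR]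
      exact sub_self _
    have h1 : 0 ≤ g ⬝ᵥ (v - R *ᵥ (A *ᵥ v)) := by
      refine hfirst _ ⟨fun i => ?_, fun i hi => ?_⟩ <;> rw [dotProduct_add, hker, add_zero]
      exacts [hys.1 i, hys.2 i hi]
    have h2 : 0 ≤ g ⬝ᵥ (-(v - R *ᵥ (A *ᵥ v))) := by
      refine hfirst _ ⟨fun i => ?_, fun i hi => ?_⟩ <;>
        rw [dotProduct_add, dotProduct_neg, hker, neg_zero, add_zero]
      exacts [hys.1 i, hys.2 i hi]
    rw [dotProduct_neg] at h2
    rw [dotProduct_sub] at h1 h2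
    linarith
  · intro i
    by_cases hi : i ∈ J
    · rw [hys.2 i hi, sub_self, mul_zero]
    · have hsl := hys.1 i
      -- Two feasible moves: loosening constraint `i` alone gives a nonnegative multiplier; moving
      -- until constraint `i` is active gives a nonpositive product of multiplier and slack.
      have h1 : 0 ≤ g ⬝ᵥ (-(R *ᵥ Pi.single i 1)) := by
        refine hfirst _ ⟨fun j => ?_, fun j hj => ?_⟩ <;> rw [dotProduct_add, dotProduct_neg, hAR]
        · rcases eq_or_ne j i with rfl | hji
          · rw [Pi.single_eq_same]
            linarith
          · rw [Pi.single_eq_of_ne hji, neg_zero, add_zero]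
            exact hys.1 j
        · rw [Pi.single_eq_of_ne (ne_of_mem_of_not_mem hj hi), neg_zero, add_zero]
          exact hys.2 j hj
      have h2 : 0 ≤ g ⬝ᵥ ((w.2 i - A i ⬝ᵥ y) • (R *ᵥ Pi.single i 1)) := by
        refine hfirst _ ⟨fun j => ?_, fun j hj => ?_⟩ <;>
          rw [dotProduct_add, dotProduct_smul, hAR, smul_eq_mul]
        · rcases eq_or_ne j i with rfl | hji
          · rw [Pi.single_eq_same]
            linarith
          · rw [Pi.single_eq_of_ne hji, mul_zero, add_zero]
            exact hys.1 j
        · rw [Pi.single_eq_of_ne (ne_of_mem_of_not_mem hj hi), mul_zero, add_zero]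
          exact hys.2 j hj
      rw [dotProduct_neg] at h1
      rw [dotProduct_smul, smul_eq_mul] at h2
      rw [hlam]
      have h3 := mul_nonneg h1 (sub_nonneg.2 hsl)
      linarith
  · intro i hi
    rw [hlam, ← dotProduct_neg]
    refine hfirst _ ⟨fun j => ?_, fun j hj => ?_⟩ <;> rw [dotProduct_add, dotProduct_neg, hAR]
    · rcases eq_or_ne j i with rfl | hji
      · rw [Pi.single_eq_same]
        have := hys.1 j
        linarith
      · rw [Pi.single_eq_of_ne hji, neg_zero, add_zero]
        exact hys.1 j
    · rw [Pi.single_eq_of_ne (ne_of_mem_of_not_mem hj hi), neg_zero, add_zero]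
      exact hys.2 j hj

end KKT

/-! ### Lipschitz constants of the argmin mapping -/

section Lipschitz

theorem eventually_perturbation_mem {c : Fin n → ℝ} {b : ι → ℝ} (α : Fin n → ℝ) (β : ι → ℝ)
    {V : Set ((Fin n → ℝ) × (ι → ℝ))} (hV : V ∈ 𝓝 (c, b)) :
    ∃ ε > 0, ((c, b) + (ε : ℝ) • (α, β)) ∈ V ∧
      ∀ α' β', ∀ᶠ t : ℝ in 𝓝[>] 0, (c, b) + ε • (α, β) + t • (α', β') ∈ V := by
  obtain ⟨V', hV'V, hV'o, hmem⟩ := mem_nhds_iff.1 hV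
  have key : ∀ (w : (Fin n → ℝ) × (ι → ℝ)) (v : (Fin n → ℝ) × (ι → ℝ)), w ∈ V' →
      ∀ᶠ t : ℝ in 𝓝[>] 0, w + t • v ∈ V' := by
    intro w v hw
    have hc : Continuous fun t : ℝ => w + t • v := by fun_prop
    have h0 : V' ∈ 𝓝 (w + (0 : ℝ) • v) := by
      rw [zero_smul, add_zero]
      exact hV'o.mem_nhds hw
    exact nhdsWithin_le_nhds (hc.continuousAt.eventually h0)
  obtain ⟨ε, hε, hε0⟩ := ((key _ (α, β) hmem).and self_mem_nhdsWithin).exists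
  refine ⟨ε, hε0, hV'V hε, fun α' β' => ?_⟩
  filter_upwards [key _ (α', β') hε] with t ht using hV'V ht

theorem eventually_mul_le {ε : ℝ} (hε : 0 < ε) (r : ℝ) : ∀ᶠ t : ℝ in 𝓝[>] 0, t * r ≤ ε := by
  have hc : Continuous fun t : ℝ => t * r := by fun_prop
  have h0 : (0 : ℝ) * r < ε := by rwa [zero_mul]
  filter_upwards [nhdsWithin_le_nhds (hc.continuousAt.eventually (gt_mem_nhds h0))] with t ht
    using le_of_lt ht

variable [Fintype ι] {Q : Matrix (Fin n) (Fin n) ℝ} {A : Matrix ι (Fin n) ℝ}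

theorem distTo_singleton (p : Seminorm ℝ (Fin n → ℝ)) (x y : Fin n → ℝ) :
    distTo p x {y} = ENNReal.ofReal (p (x - y)) := by
  simp [distTo]

theorem MixedKKT.isReducedSolution_sub {J D : Set ι} {w₁ w₂ : (Fin n → ℝ) × (ι → ℝ)}
    {y₁ y₂ : Fin n → ℝ} {l₁ l₂ : ι → ℝ} (h₁ : MixedKKT Q A J w₁ y₁ l₁)
    (h₂ : MixedKKT Q A J w₂ y₂ l₂) (hl : ∀ i ∉ D, l₁ i = 0 ∧ l₂ i = 0)
    (hA : ∀ i ∈ D, A i ⬝ᵥ y₁ = w₁.2 i ∧ A i ⬝ᵥ y₂ = w₂.2 i) :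
    IsReducedSolution Q A D (-(w₁.1 - w₂.1)) (w₁.2 - w₂.2) (y₁ - y₂) := by
  refine ⟨l₁ - l₂, fun i hi => ?_, ?_, fun i hi => ?_⟩
  · rw [Pi.sub_apply, (hl i hi).1, (hl i hi).2, sub_zero]
  · have := congrArg₂ (· - ·) h₁.stationary h₂.stationary
    simp only [sub_zero] at this
    rw [Matrix.mulVec_sub, Matrix.sub_vecMul, eq_neg_iff_add_eq_zero, ← this]
    abel
  · rw [dotProduct_sub, (hA i hi).1, (hA i hi).2, Pi.sub_apply]

theorem MixedKKT.of_pos {J : Set ι} {w : (Fin n → ℝ) × (ι → ℝ)}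
    {y : Fin n → ℝ} {l : ι → ℝ} (h : MixedKKT Q A J w y l) (hl : ∀ i ∈ J, 0 < l i) :
    MixedKKT Q A ∅ w y l where
  stationary := h.stationary
  feasible := h.feasible
  complementary := h.complementary
  active := fun i hi => (Set.notMem_empty i hi).elim
  nonneg := fun i _ => by
    by_cases hi : i ∈ J
    exacts [(hl i hi).le, h.nonneg i hi]

/-- By continuity, nonzero multipliers and nonzero slacks at `t` persist at nearby `s`. Hence `D = J
∪ {i | l s i ≠ 0}` carries both multiplier vectors and is active at both points. It may vary with
`s`; only `J ⊆ D` matters. -/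
theorem MixedKKT.exists_isReducedSolution_sub {J : Set ι}
    {w : ℝ → (Fin n → ℝ) × (ι → ℝ)} {y : ℝ → Fin n → ℝ} {l : ℝ → ι → ℝ} (hw : Continuous w)
    (hy : Continuous y) (hl : Continuous l) (h : ∀ t, MixedKKT Q A J (w t) (y t) (l t)) (t : ℝ) :
    ∀ᶠ s in 𝓝 t, ∃ D, J ⊆ D ∧
      IsReducedSolution Q A D (-((w s).1 - (w t).1)) ((w s).2 - (w t).2) (y s - y t) := by
  have h1 : ∀ᶠ s in 𝓝 t, ∀ i, l t i ≠ 0 → l s i ≠ 0 := by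
    refine Filter.eventually_all.2 fun i => ?_
    by_cases hi : l t i = 0
    · simp [hi]
    · have hc : Continuous fun s => l s i := by fun_prop
      filter_upwards [hc.continuousAt.eventually_ne hi] with s hs _ using hs
  have h2 : ∀ᶠ s in 𝓝 t, ∀ i, (w t).2 i - A i ⬝ᵥ y t ≠ 0 → (w s).2 i - A i ⬝ᵥ y s ≠ 0 := by
    refine Filter.eventually_all.2 fun i => ?_
    by_cases hi : (w t).2 i - A i ⬝ᵥ y t = 0
    · simp [hi]
    · have hc : Continuous fun s => (w s).2 i - A i ⬝ᵥ y s := by fun_prop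
      filter_upwards [hc.continuousAt.eventually_ne hi] with s hs _ using hs
  filter_upwards [h1, h2] with s hs1 hs2
  refine ⟨J ∪ {i | l s i ≠ 0}, Set.subset_union_left, (h s).isReducedSolution_sub (h t) ?_ ?_⟩
  · intro i hi
    have hs0 : l s i = 0 := by
      by_contra hne
      exact hi (Or.inr hne)
    exact ⟨hs0, by_contra fun hne => hs1 i hne hs0⟩
  · rintro i (hi | hi)
    · exact ⟨(h s).active i hi, (h t).active i hi⟩
    · have hs0 := (mul_eq_zero.1 ((h s).complementary i)).resolve_left hi
      have ht0 : (w t).2 i - A i ⬝ᵥ y t = 0 := by_contra fun hne => hs2 i hne hs0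
      exact ⟨by linarith, by linarith⟩

theorem isLipConst_of_isReducedSolution_bound [DecidableEq ι] (p : Seminorm ℝ (Fin n → ℝ))
    (hQ : Q.PosSemidef) {R : Matrix (Fin n) ι ℝ} (hR : A * R = 1) {J : Set ι}
    (hJ : KernelTrivial Q A J) {w₀ : (Fin n → ℝ) × (ι → ℝ)} {x : Fin n → ℝ} {l₀ : ι → ℝ}
    (h₀ : MixedKKT Q A J w₀ x l₀) (hl₀ : ∀ i ∈ J, 0 < l₀ i) {K : ℝ≥0}
    (hK : ∀ D, J ⊆ D → ∀ α β y, IsReducedSolution Q A D α β y → p y ≤ K * paramNorm p (α, β)) :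
    IsLipConst p (argminMap Q A) w₀ x K := by
  obtain ⟨C, hC, hlip⟩ := MixedKKT.exists_lipschitz_bound hQ hR hJ
  choose Y L hYL using exists_mixedKKT hQ hR hJ
  have hYc : Continuous Y := by
    refine (LipschitzWith.of_dist_le_mul (K := C.toNNReal) fun u v => ?_).continuous
    rw [dist_eq_norm, dist_eq_norm, Real.coe_toNNReal _ hC]
    exact (hlip _ _ _ _ _ _ (hYL u) (hYL v)).1
  have hLc : Continuous L := by
    refine (LipschitzWith.of_dist_le_mul (K := C.toNNReal) fun u v => ?_).continuous
    rw [dist_eq_norm, dist_eq_norm, Real.coe_toNNReal _ hC]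
    exact (hlip _ _ _ _ _ _ (hYL u) (hYL v)).2
  have hL₀ : L w₀ = l₀ := by
    have := (hlip _ _ _ _ _ _ (hYL w₀) h₀).2
    rw [sub_self, norm_zero, mul_zero] at this
    exact sub_eq_zero.1 (norm_le_zero_iff.1 this)
  have hpos : ∀ᶠ w in 𝓝 w₀, ∀ i, i ∈ J → 0 < L w i := by
    refine Filter.eventually_all.2 fun i => ?_
    by_cases hi : i ∈ J
    · have hc : Continuous fun w => L w i := by fun_prop
      have hi0 : 0 < L w₀ i := by
        rw [hL₀]
        exact hl₀ i hi
      filter_upwards [hc.continuousAt.eventually (lt_mem_nhds hi0)] with w hw _ using hw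
    · simp [hi]
  -- While the multipliers on `J` are positive, the minimizer is unique, so no localization in `x`
  -- is needed.
  refine ⟨Set.univ, Filter.univ_mem, {w | ∀ i ∈ J, 0 < L w i}, hpos, ?_⟩
  intro w₁ hw₁ w₂ hw₂ x₂ hx₂
  have e₁ : argminMap Q A w₁ = {Y w₁} := ((hYL w₁).of_pos hw₁).argminMap_eq hQ hJ hw₁
  have e₂ : argminMap Q A w₂ = {Y w₂} := ((hYL w₂).of_pos hw₂).argminMap_eq hQ hJ hw₂
  have hx₂' : x₂ = Y w₂ := by
    have := hx₂.1
    rwa [e₂] at this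
  rw [e₁, hx₂', distTo_singleton, ← ENNReal.ofReal_coe_nnreal,
    ← ENNReal.ofReal_mul (NNReal.coe_nonneg K)]
  refine ENNReal.ofReal_le_ofReal ?_
  let w : ℝ → (Fin n → ℝ) × (ι → ℝ) := fun t => w₁ + t • (w₂ - w₁)
  have hwc : Continuous w := by fun_prop
  have hpath := seminorm_sub_le_of_forall_right p (f := fun t => Y (w t)) (hYc.comp hwc)
    (L := K * paramNorm p (w₂ - w₁)) ?_
  · simpa [w] using hpath
  · intro t _
    have hev := MixedKKT.exists_isReducedSolution_sub hwc (hYc.comp hwc) (hLc.comp hwc)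
      (fun t => hYL (w t)) t
    filter_upwards [nhdsWithin_le_nhds hev, self_mem_nhdsWithin] with s hs hts
    obtain ⟨D, hJD, hD⟩ := hs
    have hst : 0 < s - t := sub_pos.2 hts
    refine (hK D hJD _ _ _ hD).trans_eq ?_
    have hsub : w s - w t = (s - t) • (w₂ - w₁) := by
      simp only [w]
      module
    rw [paramNorm_neg_fst, ← Prod.fst_sub, ← Prod.snd_sub, Prod.mk.eta, hsub, paramNorm_smul,
      abs_of_pos hst]
    ring

/-- The shift of `c` raises every multiplier in `D` by `ε`, and the shift of `b` gives slack `ε`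
outside `D`. These margins absorb a step `t` along the linear solution. -/
theorem kkt_perturbation {c : Fin n → ℝ} {b : ι → ℝ} {x : Fin n → ℝ} {l : ι → ℝ}
    (hstat : Q *ᵥ x + c + l ᵥ* A = 0) (hl : ∀ i, 0 ≤ l i) (hact : ∀ i, A i ⬝ᵥ x = b i)
    {D : Set ι} (hD : ∀ i ∉ D, l i = 0) {ε t : ℝ}
    {α : Fin n → ℝ} {β μ : ι → ℝ} {y : Fin n → ℝ} (hμ : ∀ i ∉ D, μ i = 0)
    (hy : Q *ᵥ y + μ ᵥ* A = α) (hA : ∀ i ∈ D, A i ⬝ᵥ y = β i)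
    (h1 : ∀ i, 0 ≤ ε + t * μ i) (h2 : ∀ i, t * (A i ⬝ᵥ y - β i) ≤ ε) :
    MixedKKT Q A ∅ ((c - ε • (D.indicator 1 ᵥ* A), b + ε • Dᶜ.indicator 1) + t • (-α, β))
      (x + t • y) (l + ε • D.indicator 1 + t • μ) := by
  refine ⟨?_, fun i => ?_, fun i => ?_, fun i hi => (Set.notMem_empty i hi).elim, fun i _ => ?_⟩
  · simp only [Prod.mk_add_mk, Prod.smul_mk, Matrix.mulVec_add, Matrix.add_vecMul,
      Matrix.mulVec_smul, Matrix.smul_vecMul]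
    rw [← hy]
    have : Q *ᵥ x + c + l ᵥ* A = 0 := hstat
    rw [← this]
    module
  · have h := h2 i
    by_cases hi : i ∈ D
    · simp [dotProduct_add, hact, hi, hA i hi]
    · simp only [Prod.mk_add_mk, Prod.smul_mk, dotProduct_add, hact, dotProduct_smul, smul_eq_mul,
        Pi.add_apply, Pi.smul_apply, Set.indicator_of_mem (Set.mem_compl hi), Pi.one_apply, mul_one]
      linarith
  · by_cases hi : i ∈ D
    · simp [dotProduct_add, hact, hi, hA i hi]
    · simp [hD i hi, hμ i hi, hi]
  · by_cases hi : i ∈ D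
    · have h := h1 i
      have h' := hl i
      simp only [Pi.add_apply, Pi.smul_apply, Set.indicator_of_mem hi, Pi.one_apply, smul_eq_mul,
        mul_one]
      linarith
    · simp [hD i hi, hμ i hi, hi]

theorem IsLipConst.isReducedSolution_bound {p : Seminorm ℝ (Fin n → ℝ)} (hQ : Q.PosSemidef)
    {c : Fin n → ℝ} {b : ι → ℝ} {x : Fin n → ℝ} {K : ℝ≥0}
    (hK : IsLipConst p (argminMap Q A) (c, b) x K) {l : ι → ℝ}
    (hstat : Q *ᵥ x + c + l ᵥ* A = 0) (hl : ∀ i, 0 ≤ l i) (hact : ∀ i, A i ⬝ᵥ x = b i)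
    {D : Set ι} (hD : ∀ i ∉ D, l i = 0) (hker : KernelTrivial Q A D)
    {α : Fin n → ℝ} {β : ι → ℝ} {y : Fin n → ℝ} (hy : IsReducedSolution Q A D α β y) :
    p y ≤ K * paramNorm p (α, β) := by
  obtain ⟨U, hU, V, hV, hUV⟩ := hK
  obtain ⟨μ, hμ, hyα, hyβ⟩ := hy
  obtain ⟨ε, hε, hεV, hεt⟩ :=
    eventually_perturbation_mem (-(D.indicator 1 ᵥ* A)) (Dᶜ.indicator 1) hV
  have hw : ((c, b) + ε • (-(D.indicator 1 ᵥ* A), Dᶜ.indicator 1) : (Fin n → ℝ) × (ι → ℝ)) =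
      (c - ε • (D.indicator 1 ᵥ* A), b + ε • Dᶜ.indicator 1) := by
    rw [Prod.smul_mk, Prod.mk_add_mk, smul_neg, sub_eq_add_neg]
  rw [hw] at hεV hεt
  -- Half of `ε` keeps the multipliers on `D` strictly positive, as uniqueness of the minimizer
  -- requires.
  have hev1 : ∀ᶠ t : ℝ in 𝓝[>] 0, ∀ i, t * -μ i ≤ ε / 2 :=
    Filter.eventually_all.2 fun i => eventually_mul_le (half_pos hε) _
  have hev2 : ∀ᶠ t : ℝ in 𝓝[>] 0, ∀ i, t * (A i ⬝ᵥ y - β i) ≤ ε :=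
    Filter.eventually_all.2 fun i => eventually_mul_le hε _
  obtain ⟨t, ⟨⟨h1, h2⟩, hV1⟩, ht : 0 < t⟩ :=
    (((hev1.and hev2).and (hεt (-α) β)).and self_mem_nhdsWithin).exists
  have hμpos : ∀ i, 0 < ε + t * μ i := fun i => by
    have := h1 i
    linarith
  have kkt₁ := kkt_perturbation hstat hl hact hD hμ hyα hyβ (fun i => (hμpos i).le) h2
  -- With `t = 0`: the point `x` itself solves the shifted problem, so the two solutions differ by
  -- exactly `t • y`.
  have kkt₂ := kkt_perturbation hstat hl hact hD (ε := ε) (t := 0) hμ hyα hyβ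
    (fun i => by simpa using hε.le) (fun i => by simpa using hε.le)
  have hS₁ := kkt₁.argminMap_eq hQ hker fun i hi => by
    have h3 := hμpos i
    have h4 := hl i
    simp only [Pi.add_apply, Pi.smul_apply, Set.indicator_of_mem hi, Pi.one_apply, smul_eq_mul,
      mul_one]
    linarith
  have hS₂ := kkt₂.argminMap_eq hQ hker fun i hi => by
    have h4 := hl i
    simp only [Pi.add_apply, Pi.smul_apply, Set.indicator_of_mem hi, Pi.one_apply, smul_eq_mul,
      mul_one, zero_mul, add_zero]
    linarith
  rw [zero_smul, zero_smul, add_zero, add_zero] at hS₂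
  have hdist := hUV _ hV1 _ hεV x ⟨by rw [hS₂]; rfl, mem_of_mem_nhds hU⟩
  rw [hS₁, distTo_singleton, ← ENNReal.ofReal_coe_nnreal,
    ← ENNReal.ofReal_mul (NNReal.coe_nonneg K), sub_add_cancel_left, sub_add_cancel_left,
    map_neg_eq_map, map_smul_eq_mul, ← neg_smul, paramNorm_smul, abs_neg,
    paramNorm_neg_fst, abs_of_pos ht, Real.norm_of_nonneg ht.le,
    ENNReal.ofReal_le_ofReal_iff (by
      have := paramNorm_nonneg p (α, β)
      positivity)] at hdist
  have h5 : t * p y ≤ t * (K * paramNorm p (α, β)) := by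
    linarith
  exact le_of_mul_le_mul_left h5 ht

theorem HasAubin.kernelTrivial {p : Seminorm ℝ (Fin n → ℝ)} (hp : ∀ x, p x = 0 → x = 0)
    (hQ : Q.PosSemidef) {c : Fin n → ℝ} {b : ι → ℝ} {x : Fin n → ℝ}
    (hAub : HasAubin p (argminMap Q A) (c, b) x) {l : ι → ℝ}
    (hstat : Q *ᵥ x + c + l ᵥ* A = 0) (hl : ∀ i, 0 ≤ l i) (hact : ∀ i, A i ⬝ᵥ x = b i)
    {D : Set ι} (hD : ∀ i ∉ D, l i = 0) : KernelTrivial Q A D := by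
  obtain ⟨K, U, hU, V, hV, hUV⟩ := hAub
  intro u hQu hAu
  by_contra hu
  have huu : 0 < u ⬝ᵥ u :=
    (Finset.sum_nonneg fun i _ => mul_self_nonneg (u i)).lt_of_ne
      fun h => hu (dotProduct_self_eq_zero.1 h.symm)
  obtain ⟨ε, hε, hεV, hεt⟩ := eventually_perturbation_mem (0 : Fin n → ℝ) (Dᶜ.indicator 1) hV
  have hw : ((c, b) + ε • (0, Dᶜ.indicator 1) : (Fin n → ℝ) × (ι → ℝ)) =
      (c, b + ε • Dᶜ.indicator 1) := by
    rw [Prod.smul_mk, Prod.mk_add_mk, smul_zero, add_zero]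
  rw [hw] at hεV hεt
  set β : ι → ℝ := b + ε • Dᶜ.indicator 1 with hβ
  have hβD : ∀ i ∈ D, β i = b i := fun i hi => by simp [hβ, hi]
  have hβD' : ∀ i ∉ D, β i = b i + ε := fun i hi => by simp [hβ, hi]
  have hlA : ∀ v, (l ᵥ* A) ⬝ᵥ v = ∑ i, l i * (A i ⬝ᵥ v) := vecMul_dotProduct_eq_sum l
  have hxS : x ∈ argminMap Q A (c, β) := by
    have kkt : MixedKKT Q A ∅ (c, β) x l := by
      refine ⟨hstat, fun i => ?_, fun i => ?_, fun i hi => (Set.notMem_empty i hi).elim,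
        fun i _ => hl i⟩
      · by_cases hi : i ∈ D
        · exact (hact i).le.trans_eq (hβD i hi).symm
        · have := hβD' i hi
          have := hact i
          linarith
      · by_cases hi : i ∈ D
        · simp [hβD i hi, hact i]
        · simp [hD i hi]
    refine ⟨kkt.feasible, fun z hz => ?_⟩
    have h1 := kkt.objective_eq hQ (z - x)
    rw [add_sub_cancel] at h1
    have h2 := dotProduct_mulVec_self_nonneg hQ (z - x)
    have h3 : 0 ≤ ∑ i, l i * (β i - A i ⬝ᵥ z) :=
      Finset.sum_nonneg fun i _ => mul_nonneg (hl i) (sub_nonneg.2 (hz i))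
    simp only at h1
    linarith
  have hcu : c ⬝ᵥ u = 0 := by
    have h1 : (Q *ᵥ x + c + l ᵥ* A) ⬝ᵥ u = 0 := by rw [hstat, zero_dotProduct]
    rw [add_dotProduct, add_dotProduct, ← dotProduct_mulVec_comm hQ, hQu, dotProduct_zero, hlA,
      Finset.sum_eq_zero, add_zero, zero_add] at h1
    · exact h1
    · intro i _
      by_cases hi : i ∈ D
      · rw [hAu i hi, mul_zero]
      · rw [hD i hi, zero_mul]
  -- If all constraints outside `D` were slack, a short step along `-u` would stay feasible and
  -- lower the objective by `t * (s * (u ⬝ᵥ u))`.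
  have hactive : ∀ s > (0 : ℝ), ∀ y ∈ argminMap Q A (c + s • u, β), ∃ i ∉ D, A i ⬝ᵥ y = β i := by
    intro s hs y hy
    by_contra! hne
    have hslack : ∀ᶠ t : ℝ in 𝓝[>] 0, ∀ i, i ∉ D → t * -(A i ⬝ᵥ u) ≤ β i - A i ⬝ᵥ y := by
      refine Filter.eventually_all.2 fun i => ?_
      by_cases hi : i ∈ D
      · simp [hi]
      · have h1 : 0 < β i - A i ⬝ᵥ y := sub_pos.2 ((hy.1 i).lt_of_ne (hne i hi))
        filter_upwards [eventually_mul_le h1 (-(A i ⬝ᵥ u))] with t ht _ using ht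
    obtain ⟨t, hts, ht : 0 < t⟩ := (hslack.and self_mem_nhdsWithin).exists
    have hfeas : y + (-t) • u ∈ feasible A β := by
      intro i
      rw [dotProduct_add, dotProduct_smul, smul_eq_mul]
      by_cases hi : i ∈ D
      · rw [hAu i hi, mul_zero, add_zero]
        exact hy.1 i
      · have := hts i hi
        linarith
    have h1 := hy.2 _ hfeas
    simp only at h1
    rw [objective_add hQ, Matrix.mulVec_smul, hQu, smul_zero, dotProduct_zero, mul_zero, add_zero,
      dotProduct_smul, add_dotProduct, ← dotProduct_mulVec_comm hQ, hQu, dotProduct_zero,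
      add_dotProduct, hcu, smul_dotProduct, smul_eq_mul, smul_eq_mul] at h1
    have h2 : 0 < t * (s * (u ⬝ᵥ u)) := by positivity
    linarith
  -- Reaching a relaxed constraint from `x` changes some `a_i'x` by `ε`, which costs distance at
  -- least `ε` over the dual norm of `a_i`; the `1` keeps `N` positive.
  set N : ℝ := 1 + ∑ i, dualNorm p (A i) with hN
  have hNpos : 0 < N := add_pos_of_pos_of_nonneg one_pos
    (Finset.sum_nonneg fun i _ => dualNorm_nonneg p _)
  have hfar : ∀ s > (0 : ℝ), ∀ y ∈ argminMap Q A (c + s • u, β), ε / N ≤ p (x - y) := by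
    intro s hs y hy
    obtain ⟨i, hi, hiy⟩ := hactive s hs y hy
    have h1 := abs_dotProduct_le_dualNorm_mul hp (A i) (x - y)
    rw [dotProduct_sub, hact i, hiy, hβD' i hi, sub_add_cancel_left, abs_neg, abs_of_pos hε] at h1
    have h2 : dualNorm p (A i) ≤ ∑ i, dualNorm p (A i) :=
      Finset.single_le_sum (f := fun i => dualNorm p (A i)) (fun i _ => dualNorm_nonneg p _)
        (Finset.mem_univ i)
    rw [div_le_iff₀ hNpos]
    have h3 := apply_nonneg p (x - y)
    nlinarith
  have hη : 0 < ε / N / 2 := by positivity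
  obtain ⟨s, ⟨hs1, hs2⟩, hs : 0 < s⟩ := (((hεt u 0).and
    (eventually_mul_le hη (K * paramNorm p (u, (0 : ι → ℝ))))).and self_mem_nhdsWithin).exists
  have hdist := hUV _ hs1 _ hεV x ⟨hxS, mem_of_mem_nhds hU⟩
  have hle : ENNReal.ofReal (ε / N) ≤
      distTo p x (argminMap Q A ((c, β) + s • (u, (0 : ι → ℝ)))) := by
    refine le_iInf₂ fun y hy => ENNReal.ofReal_le_ofReal (hfar s hs y ?_)
    simpa using hy
  have := hle.trans hdist
  rw [← ENNReal.ofReal_coe_nnreal, ← ENNReal.ofReal_mul (NNReal.coe_nonneg K), sub_add_cancel_left,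
    ← neg_smul, paramNorm_smul, abs_neg, abs_of_pos hs, ENNReal.ofReal_le_ofReal_iff (by
      have := paramNorm_nonneg p (u, (0 : ι → ℝ))
      positivity)] at this
  linarith

end Lipschitz

/-! ### KKT matrices and KKT sets of indices -/

section Submatrix

variable {Q : Matrix (Fin n) (Fin n) ℝ} {A : Matrix ι (Fin n) ℝ}

theorem exists_rows_mul_eq_one [DecidableEq ι] {D : Finset ι}
    (h : LinearIndependent ℝ (fun i : D => A i)) :
    ∃ R : Matrix (Fin n) D ℝ, rows A D * R = 1 := by
  rw [← Matrix.mulVec_surjective_iff_exists_right_inverse]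
  have hr : (rows A D).rank = Fintype.card D := LinearIndependent.rank_matrix h
  have htop : LinearMap.range (rows A D).mulVecLin = ⊤ := by
    apply Submodule.eq_top_of_finrank_eq
    rw [Module.finrank_fintype_fun_eq_card]
    exact hr
  exact LinearMap.range_eq_top.1 htop

theorem vecMul_rows_eq_of_subset {D D₀ : Finset ι} (h : D ⊆ D₀) {μ : D₀ → ℝ}
    (hμ : ∀ i : D₀, (i : ι) ∉ D → μ i = 0) :
    (fun i : D => μ ⟨i, h i.2⟩) ᵥ* rows A D = μ ᵥ* rows A D₀ := by
  ext j
  refine Finset.sum_of_injOn (fun i : D => (⟨i, h i.2⟩ : D₀)) ?_ ?_ ?_ ?_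
  · intro a _ b _ hab
    exact Subtype.ext (congrArg (fun i : D₀ => (i : ι)) hab)
  · intro a _
    simp
  · intro i _ hi
    rw [hμ i, zero_mul]
    exact fun hiD => hi ⟨⟨i, hiD⟩, by simp⟩
  · intro i _
    rfl

open scoped Classical in
/-- The extension of a vector indexed by `D` to `D₀` by zeros. -/
noncomputable def extendZero {D : Finset ι} (D₀ : Finset ι) (ν : D → ℝ) : D₀ → ℝ :=
  fun i => if h : (i : ι) ∈ D then ν ⟨i, h⟩ else 0

theorem extendZero_of_mem {D D₀ : Finset ι} (ν : D → ℝ) {i : D₀} (h : (i : ι) ∈ D) :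
    extendZero D₀ ν i = ν ⟨i, h⟩ :=
  dif_pos h

theorem extendZero_of_notMem {D D₀ : Finset ι} (ν : D → ℝ) {i : D₀} (h : (i : ι) ∉ D) :
    extendZero D₀ ν i = 0 :=
  dif_neg h

theorem extendZero_vecMul_rows {D D₀ : Finset ι} (h : D ⊆ D₀) (ν : D → ℝ) :
    extendZero D₀ ν ᵥ* rows A D₀ = ν ᵥ* rows A D := by
  rw [← vecMul_rows_eq_of_subset h fun i hi => extendZero_of_notMem ν hi]
  congr 1
  ext i
  exact extendZero_of_mem ν i.2

theorem norm_extendZero_le {D : Finset ι} (D₀ : Finset ι) (ν : D → ℝ) :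
    ‖extendZero D₀ ν‖ ≤ ‖ν‖ := by
  refine (pi_norm_le_iff_of_nonneg (norm_nonneg ν)).2 fun i => ?_
  by_cases hi : (i : ι) ∈ D
  · rw [extendZero_of_mem ν hi]
    exact norm_le_pi_norm ν _
  · rw [extendZero_of_notMem ν hi, norm_zero]
    exact norm_nonneg ν

theorem kktMatrix_mulVec (D : Finset ι) (y : Fin n → ℝ) (ν : D → ℝ) :
    kktMatrix Q A D *ᵥ Sum.elim y ν = Sum.elim (Q *ᵥ y + ν ᵥ* rows A D) (rows A D *ᵥ y) := by
  rw [kktMatrix, Matrix.fromBlocks_mulVec, Matrix.mulVec_transpose, Matrix.zero_mulVec, add_zero,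
    Sum.elim_comp_inl, Sum.elim_comp_inr]

theorem kernelTrivial_rows_iff {D D₀ : Finset ι} (h : D ⊆ D₀) :
    KernelTrivial Q (rows A D₀) {i | (i : ι) ∈ D} ↔ KernelTrivial Q A (D : Set ι) :=
  ⟨fun hk u hu hA => hk u hu fun i hi => hA i hi,
    fun hk u hu hA => hk u hu fun i hi => hA ⟨i, h hi⟩ hi⟩

variable [DecidableEq ι]

/-- For `(y, ν)` in the kernel of `M_D`, pairing the first block with `y` gives `y'Qy = 0`, hence
`Qy = 0` and `y = 0`; independence of the rows then gives `ν = 0`. -/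
theorem isUnit_kktMatrix_iff (hQ : Q.PosSemidef) {D : Finset ι}
    (hD : LinearIndependent ℝ (fun i : D => A i)) :
    IsUnit (kktMatrix Q A D) ↔ KernelTrivial Q A (D : Set ι) := by
  rw [← Matrix.mulVec_injective_iff_isUnit]
  constructor
  · intro hinj u hu hA
    have h1 : kktMatrix Q A D *ᵥ Sum.elim u 0 = kktMatrix Q A D *ᵥ 0 := by
      rw [kktMatrix_mulVec, hu, Matrix.zero_vecMul, add_zero, Matrix.mulVec_zero,
        show rows A D *ᵥ u = 0 from funext fun i => hA i i.2]
      exact Sum.elim_zero_zero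
    have h2 := hinj h1
    ext i
    exact congrFun h2 (Sum.inl i)
  · intro hk
    obtain ⟨R, hR⟩ := exists_rows_mul_eq_one hD
    refine (injective_iff_map_eq_zero (kktMatrix Q A D).mulVecLin).2 fun z hz => ?_
    rw [Matrix.mulVecLin_apply, ← Sum.elim_comp_inl_inr z, kktMatrix_mulVec] at hz
    set y := z ∘ Sum.inl
    set ν := z ∘ Sum.inr
    have h1 : Q *ᵥ y + ν ᵥ* rows A D = 0 := funext fun i => congrFun hz (Sum.inl i)
    have h2 : rows A D *ᵥ y = 0 := funext fun i => congrFun hz (Sum.inr i)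
    have h3 : Q *ᵥ y = 0 := by
      refine mulVec_eq_zero_of_dotProduct hQ ?_
      have h4 : (Q *ᵥ y + ν ᵥ* rows A D) ⬝ᵥ y = 0 := by rw [h1, zero_dotProduct]
      rw [add_dotProduct, ← Matrix.dotProduct_mulVec, h2, dotProduct_zero, add_zero] at h4
      rw [dotProduct_comm, h4]
    have hy : y = 0 := hk y h3 fun i hi => congrFun h2 ⟨i, hi⟩
    have hν : ν = 0 := by
      rw [h3, zero_add] at h1
      rw [← Matrix.vecMul_one ν, ← hR, ← Matrix.vecMul_vecMul, h1, Matrix.zero_vecMul]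
    rw [← Sum.elim_comp_inl_inr z]
    change Sum.elim y ν = 0
    rw [hy, hν]
    exact Sum.elim_zero_zero

theorem solutionMatrix_mulVec (D : Finset ι) (v : Fin n ⊕ D → ℝ) :
    solutionMatrix Q A D *ᵥ v = ((kktMatrix Q A D)⁻¹ *ᵥ v) ∘ Sum.inl := by
  rw [solutionMatrix, ← Matrix.mulVec_mulVec, Matrix.fromCols_mulVec, Matrix.one_mulVec,
    Matrix.zero_mulVec, add_zero]

theorem IsReducedSolution.eq_solutionMatrix_mulVec {D D₀ : Finset ι} (h : D ⊆ D₀)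
    (hu : IsUnit (kktMatrix Q A D)) {α : Fin n → ℝ} {β : D₀ → ℝ} {y : Fin n → ℝ}
    (hy : IsReducedSolution Q (rows A D₀) {i | (i : ι) ∈ D} α β y) :
    y = solutionMatrix Q A D *ᵥ Sum.elim α (fun i : D => β ⟨i, h i.2⟩) := by
  obtain ⟨μ, hμ, hα, hβ⟩ := hy
  have h1 : Sum.elim α (fun i : D => β ⟨i, h i.2⟩) =
      kktMatrix Q A D *ᵥ Sum.elim y (fun i : D => μ ⟨i, h i.2⟩) := by
    rw [kktMatrix_mulVec, vecMul_rows_eq_of_subset h hμ, hα]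
    congr 1
    ext i
    exact (hβ ⟨i, h i.2⟩ i.2).symm
  rw [h1, solutionMatrix_mulVec, Matrix.mulVec_mulVec,
    Matrix.nonsing_inv_mul _ ((Matrix.isUnit_iff_isUnit_det _).1 hu), Matrix.one_mulVec,
    Sum.elim_comp_inl]

theorem isReducedSolution_solutionMatrix_mulVec {D D₀ : Finset ι} (h : D ⊆ D₀)
    (hu : IsUnit (kktMatrix Q A D)) (α : Fin n → ℝ) (β : D → ℝ) :
    IsReducedSolution Q (rows A D₀) {i | (i : ι) ∈ D} α (extendZero D₀ β)
      (solutionMatrix Q A D *ᵥ Sum.elim α β) := by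
  set z := (kktMatrix Q A D)⁻¹ *ᵥ Sum.elim α β with hz
  have hMz : kktMatrix Q A D *ᵥ z = Sum.elim α β := by
    rw [hz, Matrix.mulVec_mulVec,
      Matrix.mul_nonsing_inv _ ((Matrix.isUnit_iff_isUnit_det _).1 hu), Matrix.one_mulVec]
  rw [← Sum.elim_comp_inl_inr z, kktMatrix_mulVec] at hMz
  rw [solutionMatrix_mulVec, ← hz]
  refine ⟨extendZero D₀ (z ∘ Sum.inr), fun i hi => extendZero_of_notMem _ hi, ?_, fun i hi => ?_⟩
  · rw [extendZero_vecMul_rows h]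
    exact funext fun i => congrFun hMz (Sum.inl i)
  · rw [extendZero_of_mem β hi]
    exact congrFun hMz (Sum.inr ⟨i, hi⟩)

/-! ### Multipliers and their support -/

omit [DecidableEq ι] in
theorem coneCondition_iff {c x : Fin n → ℝ} {D : Finset ι} :
    ConeCondition Q A c x D ↔
      ∃ l : D → ℝ, (∀ i, 0 ≤ l i) ∧ Q *ᵥ x + c + l ᵥ* rows A D = 0 := by
  have hsum : ∀ l : D → ℝ, l ᵥ* rows A D = ∑ i, l i • A i := fun l => by
    rw [Matrix.vecMul_eq_sum]
    rfl
  unfold ConeCondition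
  rw [PointedCone.hull, Submodule.mem_span_image_finset_iff_exists_fun]
  constructor
  · rintro ⟨l, hl⟩
    refine ⟨fun i => l i, fun i => (l i).2, ?_⟩
    rw [hsum, ← sub_neg_eq_add, sub_eq_zero, ← neg_eq_iff_eq_neg, ← hl]
    rfl
  · rintro ⟨l, hl0, hl⟩
    refine ⟨fun i => ⟨l i, hl0 i⟩, ?_⟩
    rw [hsum] at hl
    rw [neg_eq_of_add_eq_zero_right hl]
    rfl

/-- The index sets `D ⊆ D₀` with the cone condition are those containing the support `J` of the
multiplier vector. -/
theorem exists_multiplier_support {c : Fin n → ℝ} {b : ι → ℝ} {x : Fin n → ℝ} {D₀ : Finset ι}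
    (hD₀ : D₀ ∈ extendedKKT Q A c b x) :
    ∃ (J : Finset ι) (l : D₀ → ℝ), J ⊆ D₀ ∧ Q *ᵥ x + c + l ᵥ* rows A D₀ = 0 ∧
      (∀ i : D₀, (i : ι) ∈ J → 0 < l i) ∧ (∀ i : D₀, (i : ι) ∉ J → l i = 0) ∧
      ∀ D ⊆ D₀, (ConeCondition Q A c x D ↔ J ⊆ D) := by
  obtain ⟨-, hind, hcone⟩ := hD₀
  obtain ⟨l, hl0, hl⟩ := coneCondition_iff.1 hcone
  obtain ⟨R, hR⟩ := exists_rows_mul_eq_one hind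
  set J : Finset ι := (Finset.univ.filter fun i : D₀ => 0 < l i).map ⟨_, Subtype.val_injective⟩
    with hJ
  have hJmem : ∀ i : D₀, (i : ι) ∈ J ↔ 0 < l i := fun i => by simp [hJ]
  have hJD₀ : J ⊆ D₀ := fun i hi => by
    obtain ⟨j, -, rfl⟩ := Finset.mem_map.1 hi
    exact j.2
  have hzero : ∀ i : D₀, (i : ι) ∉ J → l i = 0 := fun i hi =>
    le_antisymm (not_lt.1 fun h => hi ((hJmem i).2 h)) (hl0 i)
  refine ⟨J, l, hJD₀, hl, fun i hi => (hJmem i).1 hi, hzero, fun D hD => ⟨fun hcD => ?_, fun hJD =>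
    coneCondition_iff.2 ⟨fun i : D => l ⟨i, hD i.2⟩, fun i => hl0 _, ?_⟩⟩⟩
  · obtain ⟨l', -, hl'⟩ := coneCondition_iff.1 hcD
    -- Multipliers on `D₀` are unique because `rows A D₀` has a right inverse; the padded `l'` must
    -- therefore be `l`.
    have heq : l = extendZero D₀ l' := by
      have h1 : l ᵥ* rows A D₀ = extendZero D₀ l' ᵥ* rows A D₀ := by
        rw [extendZero_vecMul_rows hD]
        exact add_left_cancel (hl.trans hl'.symm)
      have h2 := congrArg (fun v => v ᵥ* R) h1
      simpa only [Matrix.vecMul_vecMul, hR, Matrix.vecMul_one] using h2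
    intro i hi
    by_contra hiD
    have h3 := (hJmem ⟨i, hJD₀ hi⟩).1 hi
    rw [heq, extendZero_of_notMem l' hiD] at h3
    exact lt_irrefl _ h3
  · rw [vecMul_rows_eq_of_subset hD fun i hi => hzero i fun h => hi (hJD h)]
    exact hl

omit [DecidableEq ι] in
theorem mem_extendedKKT_of_subset {c : Fin n → ℝ} {b : ι → ℝ} {x : Fin n → ℝ} {D D₀ : Finset ι}
    (hD₀ : D₀ ∈ extendedKKT Q A c b x) (h : D ⊆ D₀) (hD : ConeCondition Q A c x D) :
    D ∈ extendedKKT Q A c b x :=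
  ⟨fun _ hi => hD₀.1 (h hi),
    hD₀.2.1.comp (fun i : D => (⟨i, h i.2⟩ : D₀)) fun _ _ hab =>
      Subtype.ext (congrArg (fun i : D₀ => (i : ι)) hab), hD⟩

/-! ### The Aubin property and the Lipschitz modulus -/

theorem IsLipConst.matNorm_le {p : Seminorm ℝ (Fin n → ℝ)}
    (hQ : Q.PosSemidef) {c : Fin n → ℝ} {b : ι → ℝ} {x : Fin n → ℝ} {D D₀ : Finset ι}
    (hD₀ : D₀ ∈ extendedKKT Q A c b x) {K : ℝ≥0}
    (hK : IsLipConst p (argminMap Q (rows A D₀)) (c, coords b D₀) x K)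
    (hDD₀ : D ⊆ D₀) (hD : ConeCondition Q A c x D) (hu : IsUnit (kktMatrix Q A D)) :
    matNorm p (solutionMatrix Q A D) ≤ K := by
  obtain ⟨J, l, hJ, hstat, hpos, hzero, hcone⟩ := exists_multiplier_support hD₀
  have hJD := (hcone D hDD₀).1 hD
  have hl : ∀ i, 0 ≤ l i := fun i => by
    by_cases hi : (i : ι) ∈ J
    exacts [(hpos i hi).le, (hzero i hi).ge]
  have hker : KernelTrivial Q (rows A D₀) {i | (i : ι) ∈ D} := (kernelTrivial_rows_iff hDD₀).2
    ((isUnit_kktMatrix_iff hQ (mem_extendedKKT_of_subset hD₀ hDD₀ hD).2.1).1 hu)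
  refine QuadArgmin.matNorm_le K.2 fun α β => ?_
  refine (hK.isReducedSolution_bound hQ hstat hl (fun i => hD₀.1 i.2)
    (fun i hi => hzero i fun h => hi (hJD h)) hker
    (isReducedSolution_solutionMatrix_mulVec hDD₀ hu α β)).trans ?_
  -- Padding by zeros does not increase the supremum norm, so a bound over `D₀` yields one over `D`.
  exact mul_le_mul_of_nonneg_left (max_le_max le_rfl (norm_extendZero_le D₀ β)) K.2

theorem HasAubin.kernelTrivial_of_coneCondition {p : Seminorm ℝ (Fin n → ℝ)}
    (hp : ∀ x, p x = 0 → x = 0) (hQ : Q.PosSemidef) {c : Fin n → ℝ} {b : ι → ℝ} {x : Fin n → ℝ}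
    {D D₀ : Finset ι} (hD₀ : D₀ ∈ extendedKKT Q A c b x)
    (hA : HasAubin p (argminMap Q (rows A D₀)) (c, coords b D₀) x)
    (hDD₀ : D ⊆ D₀) (hD : ConeCondition Q A c x D) : KernelTrivial Q A (D : Set ι) := by
  obtain ⟨J, l, hJ, hstat, hpos, hzero, hcone⟩ := exists_multiplier_support hD₀
  have hJD := (hcone D hDD₀).1 hD
  have hl : ∀ i, 0 ≤ l i := fun i => by
    by_cases hi : (i : ι) ∈ J
    exacts [(hpos i hi).le, (hzero i hi).ge]
  exact (kernelTrivial_rows_iff hDD₀).1 (hA.kernelTrivial hp hQ hstat hl (fun i => hD₀.1 i.2)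
    fun i hi => hzero i fun h => hi (hJD h))

theorem isLipConst_of_matNorm_le {p : Seminorm ℝ (Fin n → ℝ)}
    (hp : ∀ x, p x = 0 → x = 0) (hQ : Q.PosSemidef) {c : Fin n → ℝ} {b : ι → ℝ} {x : Fin n → ℝ}
    {D₀ : Finset ι} (hD₀ : D₀ ∈ extendedKKT Q A c b x)
    (hu : ∀ D ∈ extendedKKT Q A c b x, D ⊆ D₀ → IsUnit (kktMatrix Q A D)) {K : ℝ≥0}
    (hK : ∀ D ∈ extendedKKT Q A c b x, D ⊆ D₀ → matNorm p (solutionMatrix Q A D) ≤ K) :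
    IsLipConst p (argminMap Q (rows A D₀)) (c, coords b D₀) x K := by
  classical
  obtain ⟨J, l, hJ, hstat, hpos, hzero, hcone⟩ := exists_multiplier_support hD₀
  obtain ⟨R, hR⟩ := exists_rows_mul_eq_one hD₀.2.1
  have hJext := mem_extendedKKT_of_subset hD₀ hJ ((hcone J hJ).2 subset_rfl)
  have hact : ∀ i : D₀, rows A D₀ i ⬝ᵥ x = coords b D₀ i := fun i => hD₀.1 i.2
  have hker : KernelTrivial Q (rows A D₀) {i | (i : ι) ∈ J} := (kernelTrivial_rows_iff hJ).2
    ((isUnit_kktMatrix_iff hQ hJext.2.1).1 (hu J hJext hJ))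
  have hkkt : MixedKKT Q (rows A D₀) {i | (i : ι) ∈ J} (c, coords b D₀) x l :=
    ⟨hstat, fun i => (hact i).le, fun i => by rw [hact, sub_self, mul_zero], fun i _ => hact i,
      fun i hi => (hzero i hi).ge⟩
  refine isLipConst_of_isReducedSolution_bound p hQ hR hker hkkt hpos fun E hJE α β y hy => ?_
  set D : Finset ι := (Finset.univ.filter fun i : D₀ => i ∈ E).map ⟨_, Subtype.val_injective⟩
    with hD
  have hDmem : ∀ i : D₀, (i : ι) ∈ D ↔ i ∈ E := fun i => by simp [hD]
  have hDD₀ : D ⊆ D₀ := fun i hi => by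
    obtain ⟨j, -, rfl⟩ := Finset.mem_map.1 hi
    exact j.2
  have hJD : J ⊆ D := fun i hi => (hDmem ⟨i, hJ hi⟩).2 (hJE hi)
  have hDext := mem_extendedKKT_of_subset hD₀ hDD₀ ((hcone D hDD₀).2 hJD)
  have hE : E = {i : D₀ | (i : ι) ∈ D} := Set.ext fun i => (hDmem i).symm
  rw [hE] at hy
  rw [hy.eq_solutionMatrix_mulVec hDD₀ (hu D hDext hDD₀)]
  refine (le_matNorm_mul hp _ _ _).trans ?_
  refine mul_le_mul (hK D hDext hDD₀) (max_le_max le_rfl ?_) (paramNorm_nonneg p _) K.2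
  exact (pi_norm_le_iff_of_nonneg (norm_nonneg β)).2 fun i => norm_le_pi_norm β _

theorem exists_isLipConst_matNorm [Finite ι] {p : Seminorm ℝ (Fin n → ℝ)}
    (hp : ∀ x, p x = 0 → x = 0) (hQ : Q.PosSemidef) {c : Fin n → ℝ} {b : ι → ℝ} {x : Fin n → ℝ}
    {D₀ : Finset ι} (hD₀ : D₀ ∈ extendedKKT Q A c b x)
    (hu : ∀ D ∈ extendedKKT Q A c b x, D ⊆ D₀ → IsUnit (kktMatrix Q A D)) :
    ∃ D ∈ extendedKKT Q A c b x, D ⊆ D₀ ∧ IsLipConst p (argminMap Q (rows A D₀))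
      (c, coords b D₀) x (matNorm p (solutionMatrix Q A D)).toNNReal := by
  obtain ⟨D, hD, hmax⟩ := Set.exists_max_image {D | D ∈ extendedKKT Q A c b x ∧ D ⊆ D₀}
    (fun D => matNorm p (solutionMatrix Q A D)) (Set.toFinite _) ⟨D₀, hD₀, subset_rfl⟩
  refine ⟨D, hD.1, hD.2, isLipConst_of_matNorm_le hp hQ hD₀ hu fun E hE hED₀ => ?_⟩
  rw [Real.coe_toNNReal _ (matNorm_nonneg _ _)]
  exact hmax E ⟨hE, hED₀⟩

end Submatrix

end QuadArgmin

open QuadArgmin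
theorem mainTheorem9 {n m : ℕ} (p : Seminorm ℝ (Fin n → ℝ)) (hp : ∀ x, p x = 0 → x = 0)
    (Q : Matrix (Fin n) (Fin n) ℝ) (hQ : Q.PosSemidef) (A : Matrix (Fin m) (Fin n) ℝ)
    (c : Fin n → ℝ) (b : Fin m → ℝ) (x : Fin n → ℝ)
    (hSlater : Slater A b) (hS : argminMap Q A (c, b) = {x})
    (D₀ : Finset (Fin m)) (hD₀ : D₀ ∈ extendedKKT Q A c b x) :
    List.TFAE
      [HasAubin p (argminMap Q (rows A D₀)) (c, coords b D₀) x,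
        ∀ D ∈ minimalKKT Q A c b x, D ⊆ D₀ →
          HasAubin p (argminMap Q (rows A D)) (c, coords b D) x,
        ∀ D ∈ extendedKKT Q A c b x, D ⊆ D₀ →
          HasAubin p (argminMap Q (rows A D)) (c, coords b D) x,
        ∀ D ∈ extendedKKT Q A c b x, D ⊆ D₀ → IsUnit (kktMatrix Q A D)] ∧
    (HasAubin p (argminMap Q (rows A D₀)) (c, coords b D₀) x →
      IsGreatest
        ((fun D : Finset (Fin m) => ENNReal.ofReal (matNorm p (solutionMatrix Q A D))) ''
          {D | D ∈ extendedKKT Q A c b x ∧ D ⊆ D₀})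
        (lipModulus p (argminMap Q (rows A D₀)) (c, coords b D₀) x)) := by
  have h14 : HasAubin p (argminMap Q (rows A D₀)) (c, coords b D₀) x →
      ∀ D ∈ extendedKKT Q A c b x, D ⊆ D₀ → IsUnit (kktMatrix Q A D) := fun h D hD hDD₀ =>
    (isUnit_kktMatrix_iff hQ hD.2.1).2 (h.kernelTrivial_of_coneCondition hp hQ hD₀ hDD₀ hD.2.2)
  refine ⟨?_, fun hA => ?_⟩
  · tfae_have 1 → 4 := h14
    tfae_have 4 → 3 := fun h D hD hDD₀ => by
      obtain ⟨E, -, -, hE⟩ := exists_isLipConst_matNorm hp hQ hD fun F hF hFD =>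
        h F hF (hFD.trans hDD₀)
      exact ⟨_, hE⟩
    tfae_have 3 → 1 := fun h => h D₀ hD₀ subset_rfl
    tfae_have 3 → 2 := fun h D hD hDD₀ =>
      h D (mem_extendedKKT_of_subset hD₀ hDD₀ hD.2.prop) hDD₀
    -- The support `J` is itself minimal, and a trivial common kernel for `J` persists for every
    -- larger set.
    tfae_have 2 → 4 := fun h D hD hDD₀ => by
      obtain ⟨J, l, hJ, -, -, -, hcone⟩ := exists_multiplier_support hD₀
      have hJc := (hcone J hJ).2 subset_rfl
      have hJext := mem_extendedKKT_of_subset hD₀ hJ hJc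
      have hJmin : J ∈ minimalKKT Q A c b x :=
        ⟨hJext.1, hJc, fun E hE hEJ => (hcone E (hEJ.trans hJ)).1 hE⟩
      have hker := (h J hJmin hJ).kernelTrivial_of_coneCondition hp hQ hJext subset_rfl hJc
      exact (isUnit_kktMatrix_iff hQ hD.2.1).2
        (hker.mono (Finset.coe_subset.2 ((hcone D hDD₀).1 hD.2.2)))
    tfae_finish
  · have hu := h14 hA
    have hup : ∀ D ∈ extendedKKT Q A c b x, D ⊆ D₀ →
        ENNReal.ofReal (matNorm p (solutionMatrix Q A D)) ≤
          lipModulus p (argminMap Q (rows A D₀)) (c, coords b D₀) x := fun D hD hDD₀ =>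
      le_iInf₂ fun K hK => ENNReal.ofReal_le_of_le_toReal
        (hK.matNorm_le hQ hD₀ hDD₀ hD.2.2 (hu D hD hDD₀))
    -- The largest of the finitely many norms is itself a Lipschitz constant, so the infimum equals
    -- it.
    obtain ⟨D, hD, hDD₀, hlip⟩ := exists_isLipConst_matNorm hp hQ hD₀ hu
    refine ⟨⟨D, ⟨hD, hDD₀⟩, le_antisymm (hup D hD hDD₀) (iInf₂_le _ hlip)⟩, ?_⟩
    rintro _ ⟨E, ⟨hE, hED₀⟩, rfl⟩
    exact hup E hE hED₀
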